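/- **Definitions.** An *incidence complex of rank $k$* (a $k$-complex) is a poset, whose elements are called faces, such that: (I1) it has a least and a greatest face; (I2) every chain is contained in a maximal chain (a *flag*) with exactly $k+2$ faces, so that faces have ranks $-1,0,\dots,k$; (I3) any two flags $\Phi,\Psi$ can be joined by a finite sequence of flags, all containing $\Phi\cap\Psi$, in which successive flags differ in exactly one face; (I4) there are finite numbers $c_0,\dots,c_{k-1}\ge 2$ such that whenever $F<G$ have ranks $i-1$ and $i+1$, exactly $c_i$ faces of rank $i$ lie strictly between them. It is *regular* if its automorphism group is transitive on flags. *Vertices* are faces of rank $0$, and the *vertex-set* $V(F)$ of a face $F$ is the set of vertices $\le F$. A system of subgroups $R_{-1},R_0,\dots,R_m$ of a group $\Gamma$ is called *distinguished* if $R_{-1}=R_m$; $\Gamma=\langle R_{-1},\dots,R_m\rangle$; $R_iR_j=R_jR_i$ for $-1\le i<j-1\le m-1$ (commutation property); and $\Gamma_I\cap\Gamma_J=\Gamma_{I\cap J}$ for all $I,J\subseteq\{-1,\dots,m\}$ (intersection property), where $\Gamma_I:=\langle R_{-1},\,R_i : i\in I\rangle$. (Thus $R_{-1}$ is understood to be included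 in every $\Gamma_I$; in particular $\Gamma_\emptyset=R_{-1}$.) Its *coset complex* has as $i$-faces ($-1\le i\le m$) the cosets of $\Gamma_{\{-1,\dots,m\}\setminus\{i\}}$ in $\Gamma$, and an $i$-face is $\le$ a $j$-face if $i\le j$ and the two cosets intersect. Let $n\ge2$ and $N=\{1,\dots,n\}$, and let $\mathcal K$ be a finite complex with vertex-set $V$. For a face $F$ of $\mathcal K$ and $\varepsilon\in N^V$ put $F(\varepsilon)=\{\eta\in N^V : \eta_i=\varepsilon_i \text{ for } i\notin V(F)\}$. The *power complex* $n^{\mathcal K}$ consists of a least face $\emptyset$ and the faces $F(\varepsilon)$, each taken together with the face $F$ it comes from, where $F(\varepsilon)\le F'(\varepsilon')$ if and only if $F\le F'$ and $\varepsilon_i=\varepsilon'_i$ for all $i\notin V(F')$. For $U\le S_n$ the wreath product $U\wr\Gamma(\mathcal K)=U^V\rtimes\Gamma(\mathcal K)$, with $\Gamma(\mathcal K)$ permuting the coordinates, acts on $n^{\mathcal K}$: $U^V$ acts coordinatewise on vectors, and $\varphi\in\Gamma(\mathcal K)$ permutes the coordinates and sends faces coming from $F$ to faces coming from the image of $F$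 under $\varphi$. **Theorem.** Let $\mathcal K$ be a finite regular incidence complex of rank $k\ge1$ with base flag $\{F_{-1},F_0,\dots,F_k\}$. For $-1\le i\le k$ let $R_i\le\Gamma(\mathcal K)$ be the stabilizer of all $F_j$ with $j\ne i$ (so $R_{-1}=R_k$ is the stabilizer of the base flag). Let $n\ge2$. (a) Let $C_n\le S_n$ be generated by an $n$-cycle, and in $\Gamma=C_n\wr\Gamma(\mathcal K)$ let $\sigma_F$ be that generator in the coordinate $F$. Put $$\widehat R_0=\langle\sigma_{F_0}\rangle,\qquad \widehat R_i=R_{i-1}\ (1\le i\le k),\qquad \widehat R_{-1}=\widehat R_{k+1}=R_{-1}.$$ Then $\Gamma=\langle\widehat R_0,\dots,\widehat R_k\rangle$, and $\widehat R_{-1},\dots,\widehat R_{k+1}$ is a distinguished system of subgroups of $\Gamma$. Its coset complex is (with the relation above, which is a partial order) a regular incidence complex of rank $k+1$, on which $\Gamma$ acts faithfully and flag-transitively by translation; so $\Gamma$ is a flag-transitive subgroup of its automorphism group. This complex is isomorphic to $n^{\mathcal K}$, by an isomorphism that carries the action of $\Gamma$ by translation to its action on $n^{\mathcal K}$. (b)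 The same holds with $C_n$ replaced by any subgroup $U\le S_n$ that is transitive on $N$, and any point $o\in N$ with stabilizer $U_o$ in $U$: in $\Gamma=U\wr\Gamma(\mathcal K)$ one takes for $\widehat R_0$ the copy of $U$ in the coordinate $F_0$, $\widehat R_i=R_{i-1}$ for $1\le i\le k$, and $\widehat R_{-1}=\widehat R_{k+1}=U_o\wr R_{-1}$. (c) If the faces of $\mathcal K$ are determined by their vertex-sets, then the faces of $n^{\mathcal K}$ are determined by the sets $\emptyset$, $F(\varepsilon)$. If moreover $F\le G\Leftrightarrow V(F)\subseteq V(G)$ for all faces $F,G$ of $\mathcal K$, then the order of $n^{\mathcal K}$ is the inclusion of these sets. -/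

import Mathlib

open scoped Pointwise

/-- The rank of a face: one less than the length of a longest chain that ends at the face, so that
a least face has rank `-1`. -/
noncomputable def faceRank {P : Type*} [PartialOrder P] (F : P) : ℤ :=
  ((Order.height F).toNat : ℤ) - 1

/-- Two flags (maximal chains) are adjacent if they differ in exactly one face. -/
def FlagAdjacent {P : Type*} [PartialOrder P] (A B : Flag P) : Prop :=
  ((A : Set P) \ (B : Set P)).encard = 1 ∧ ((B : Set P) \ (A : Set P)).encard = 1

/-- Incidence complexes of rank `k` (with finite homogeneity parameters). -/
structure IsIncidenceComplex (k : ℕ) (P : Type*) [PartialOrder P] : Prop where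
  /-- there is a least face -/
  exists_least : ∃ F : P, ∀ G, F ≤ G
  /-- there is a greatest face -/
  exists_greatest : ∃ F : P, ∀ G, G ≤ F
  /-- every chain lies in a maximal chain with exactly `k + 2` faces -/
  chain_subset_flag : ∀ C : Set P, IsChain (· ≤ ·) C →
    ∃ Φ : Flag P, C ⊆ (Φ : Set P) ∧ (Φ : Set P).encard = k + 2
  /-- strong flag-connectedness -/
  strongly_flag_connected : ∀ Φ Ψ : Flag P,
    Relation.ReflTransGen
      (fun A B : Flag P => FlagAdjacent A B ∧
        (Φ : Set P) ∩ (Ψ : Set P) ⊆ (A : Set P) ∧ (Φ : Set P) ∩ (Ψ : Set P) ⊆ (B : Set P)) Φ Ψ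
  /-- homogeneity -/
  homogeneous : ∃ c : ℤ → ℕ, ∀ i : ℤ, 0 ≤ i → i ≤ (k : ℤ) - 1 →
    2 ≤ c i ∧ ∀ F G : P, faceRank F = i - 1 → faceRank G = i + 1 → F < G →
      {H : P | faceRank H = i ∧ F < H ∧ H < G}.encard = c i

/-- A group acting by automorphisms is transitive on the flags. -/
def FlagTransitive {G P : Type*} [Group G] [PartialOrder P] (ρ : G →* (P ≃o P)) : Prop :=
  ∀ Φ Ψ : Flag P, ∃ g : G, Flag.map (ρ g) Φ = Ψ

/-- The full automorphism group is transitive on the flags. -/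
def IsRegularComplex (P : Type*) [PartialOrder P] : Prop :=
  FlagTransitive (MonoidHom.id (P ≃o P))

/-! ### Groups with a system of subgroups, and their coset complexes -/

/-- `Γ_I`, the subgroup generated by the `R i` with `i ∈ I` together with `R (-1)` (the stabilizer
of the base flag, which is understood to be present in every `Γ_I`). -/
def genSubgroup {G : Type*} [Group G] (R : ℤ → Subgroup G) (I : Set ℤ) : Subgroup G :=
  R (-1) ⊔ ⨆ i ∈ I, R i

/-- The defining properties of a system of generating subgroups `R (-1), R 0, …, R m`. -/
structure IsDistinguishedSystem {G : Type*} [Group G] (m : ℕ) (R : ℤ → Subgroup G) : Prop where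
  ends_eq : R (-1) = R m
  generate : (⨆ i ∈ Set.Icc (-1 : ℤ) m, R i) = ⊤
  commute : ∀ i j : ℤ, -1 ≤ i → i < j - 1 → j ≤ m →
    (R i : Set G) * (R j : Set G) = (R j : Set G) * (R i : Set G)
  inter : ∀ I J : Set ℤ, I ⊆ Set.Icc (-1) (m : ℤ) → J ⊆ Set.Icc (-1) (m : ℤ) →
    genSubgroup R I ⊓ genSubgroup R J = genSubgroup R (I ∩ J)

/-- The faces of the coset complex: an `i`-face, for `-1 ≤ i ≤ m`, is a coset of
`Γ_{{-1,…,m} ∖ {i}}`. Automorphisms act on the left here, hence left cosets. -/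
structure CosetFace {G : Type*} [Group G] (m : ℕ) (R : ℤ → Subgroup G) where
  idx : ℤ
  idx_mem : idx ∈ Set.Icc (-1 : ℤ) m
  coset : G ⧸ genSubgroup R (Set.Icc (-1 : ℤ) m \ {idx})

/-- Incidence in the coset complex: the rank does not decrease and the cosets meet. -/
def CosetFace.Below {G : Type*} [Group G] {m : ℕ} {R : ℤ → Subgroup G}
    (x y : CosetFace m R) : Prop :=
  x.idx ≤ y.idx ∧ ∃ g : G, (QuotientGroup.mk g = x.coset) ∧ (QuotientGroup.mk g = y.coset)

/-- Left translation of a coset face. -/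
def CosetFace.translate {G : Type*} [Group G] {m : ℕ} {R : ℤ → Subgroup G}
    (g : G) (x : CosetFace m R) : CosetFace m R :=
  ⟨x.idx, x.idx_mem, g • x.coset⟩

/-- The coset complex of `(G, R)` is a regular incidence complex of rank `m`, on which `G` acts
faithfully and flag-transitively by translation, and it is isomorphic to `P` by an isomorphism
that carries translation by `g` to the map `α g` of `P`, for each `g` in `G`. -/
def CosetComplexRecovers {G : Type*} [Group G] (m : ℕ) (R : ℤ → Subgroup G)
    (P : Type*) [PartialOrder P] (α : G → P → P) : Prop :=
  ∃ _ : PartialOrder (CosetFace m R),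
    (∀ x y : CosetFace m R, x ≤ y ↔ x.Below y) ∧
    IsIncidenceComplex m (CosetFace m R) ∧
    IsRegularComplex (CosetFace m R) ∧
    ∃ ρ : G →* (CosetFace m R ≃o CosetFace m R),
      (∀ g x, ρ g x = x.translate g) ∧
      Function.Injective ρ ∧
      FlagTransitive ρ ∧
      ∃ e : CosetFace m R ≃o P, ∀ g x, e (ρ g x) = α g (e x)

/-! ### Stabilizers in the automorphism group of a complex -/

/-- `R i`: the automorphisms that fix every face of the flag `Φ` except possibly its `i`-face. -/
def flagSubgroup {K : Type*} [PartialOrder K] (Φ : Flag K) (i : ℤ) : Subgroup (K ≃o K) where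
  carrier := {φ | ∀ F ∈ Φ, faceRank F ≠ i → φ F = F}
  one_mem' := fun _ _ _ => rfl
  mul_mem' := fun {a b} ha hb F hF hi => by
    rw [RelIso.mul_apply, hb F hF hi, ha F hF hi]
  inv_mem' := fun {a} ha F hF hi => by
    have h := congrArg (a⁻¹ : K ≃o K) (ha F hF hi)
    rw [RelIso.inv_apply_self] at h
    exact h.symm

/-- The vertices of `K`. -/
def Vertex (K : Type*) [PartialOrder K] : Type _ := {F : K // faceRank F = 0}

/-- The vertex-set of a face. -/
def vertexSet {K : Type*} [PartialOrder K] (F : K) : Set (Vertex K) := {H | H.1 ≤ F}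

theorem faceRank_apply {K : Type*} [PartialOrder K] (φ : K ≃o K) (F : K) :
    faceRank (φ F) = faceRank F := by
  simp [faceRank]

/-- The action of the automorphism group on the vertices. -/
instance vertexAction (K : Type*) [PartialOrder K] : MulAction (K ≃o K) (Vertex K) where
  smul φ H := ⟨φ H.1, (faceRank_apply φ H.1).trans H.2⟩
  one_smul _ := rfl
  mul_smul _ _ _ := rfl

/-! ### Wreath products -/

/-- The action of the automorphism group on `A ^ V` by permutation of the coordinates. -/
def coordAut (A : Type*) [Group A] (K : Type*) [PartialOrder K] :
    (K ≃o K) →* MulAut (Vertex K → A) where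
  toFun φ :=
    { toFun := fun u H => u (φ⁻¹ • H)
      invFun := fun u H => u (φ • H)
      left_inv := fun u => by funext H; simp
      right_inv := fun u => by funext H; simp
      map_mul' := fun _ _ => rfl }
  map_one' := by ext u H; simp
  map_mul' φ ψ := by ext u H; simp [mul_smul]

/-- The wreath product `A ≀ Γ(K) = A ^ V ⋊ Γ(K)`. -/
abbrev Wreath (A : Type*) [Group A] (K : Type*) [PartialOrder K] :=
  (Vertex K → A) ⋊[coordAut A K] (K ≃o K)

/-- `σ_F a`: the element `a` in the coordinate `F`. -/
noncomputable def coordElt {A : Type*} [Group A] {K : Type*} [PartialOrder K] (F : Vertex K)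
    (a : A) : Wreath A K :=
  open Classical in SemidirectProduct.inl (Pi.mulSingle F a)

/-- The copy of `A` in the coordinate `F`. -/
noncomputable def coordSubgroup (A : Type*) [Group A] {K : Type*} [PartialOrder K]
    (F : Vertex K) : Subgroup (Wreath A K) :=
  Subgroup.closure (Set.range (coordElt (A := A) F))

/-- The system for `C_n ≀ Γ(K)`, where `C_n` is generated by `c`. The indices `-1` and `k + 1` carry
the stabilizer of the base flag. -/
noncomputable def cyclicSystem {n : ℕ} (c : Equiv.Perm (Fin n)) (k : ℕ) {K : Type*}
    [PartialOrder K] (Φ : Flag K) (F₀ : Vertex K) (i : ℤ) :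
    Subgroup (Wreath (Subgroup.zpowers c) K) :=
  if i = 0 then Subgroup.zpowers (coordElt F₀ ⟨c, Subgroup.mem_zpowers c⟩)
  else if 1 ≤ i ∧ i ≤ k then (flagSubgroup Φ (i - 1)).map SemidirectProduct.inr
  else (flagSubgroup Φ (-1)).map SemidirectProduct.inr

/-- The system for `U ≀ Γ(K)`, with base point `o`. The indices `-1` and `k + 1` carry the subgroup
`U_o ≀ R_{-1}`, the stabilizer of the base flag of the power complex. -/
noncomputable def transitiveSystem {n : ℕ} (U : Subgroup (Equiv.Perm (Fin n))) (o : Fin n) (k : ℕ)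
    {K : Type*} [PartialOrder K] (Φ : Flag K) (F₀ : Vertex K) (i : ℤ) :
    Subgroup (Wreath U K) :=
  if i = 0 then coordSubgroup U F₀
  else if 1 ≤ i ∧ i ≤ k then (flagSubgroup Φ (i - 1)).map SemidirectProduct.inr
  else
    (Subgroup.pi Set.univ fun _ : Vertex K => MulAction.stabilizer U o).map SemidirectProduct.inl ⊔
      (flagSubgroup Φ (-1)).map SemidirectProduct.inr

/-! ### Power complexes -/

/-- `F(ε)`: the vectors that agree with `ε` in all coordinates outside the vertex-set of `F`. -/
def powerCell {n : ℕ} {K : Type*} [PartialOrder K] (F : K) (ε : Vertex K → Fin n) :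
    Set (Vertex K → Fin n) :=
  {η | ∀ H, H ∉ vertexSet F → η H = ε H}

/-- The faces of `n ^ K` other than the least one: the sets `F(ε)`, each together with the face `F`
it comes from. They are ordered by `F(ε) ≤ F'(ε')` iff `F ≤ F'` and `F(ε) ⊆ F'(ε')`. -/
abbrev ProperPowerFace (n : ℕ) (K : Type*) [PartialOrder K] :=
  {p : K × Set (Vertex K → Fin n) // ∃ ε, p.2 = powerCell p.1 ε}

/-- The power complex `n ^ K`, with the empty face as least face. -/
abbrev PowerComplex (n : ℕ) (K : Type*) [PartialOrder K] := WithBot (ProperPowerFace n K)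

/-- The set of vectors that makes up a face of `n ^ K`. -/
def powerSet {n : ℕ} {K : Type*} [PartialOrder K] : PowerComplex n K → Set (Vertex K → Fin n)
  | ⊥ => ∅
  | (p : ProperPowerFace n K) => p.1.2

/-- The action of `(u, φ) ∈ U ≀ Γ(K)` on vectors: permute the coordinates by `φ`, then apply `u`
coordinatewise. -/
def vectorAct {n : ℕ} {K : Type*} [PartialOrder K] {U : Subgroup (Equiv.Perm (Fin n))}
    (w : Wreath U K) (ε : Vertex K → Fin n) : Vertex K → Fin n :=
  fun H => w.left H • ε (w.right⁻¹ • H)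

theorem vectorAct_image {n : ℕ} {K : Type*} [PartialOrder K] {U : Subgroup (Equiv.Perm (Fin n))}
    (w : Wreath U K) (F : K) (ε : Vertex K → Fin n) :
    vectorAct w '' powerCell F ε = powerCell (w.right F) (vectorAct w ε) := by
  have key : ∀ H : Vertex K, w.right • H ∈ vertexSet (w.right F) ↔ H ∈ vertexSet F := fun H =>
    w.right.le_iff_le
  ext η
  constructor
  · rintro ⟨ζ, hζ, rfl⟩ H hH
    have h := hζ (w.right⁻¹ • H) (fun h => hH (by simpa using (key (w.right⁻¹ • H)).2 h))
    simp only [vectorAct, h]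
  · intro h
    refine ⟨fun H => (w.left (w.right • H))⁻¹ • η (w.right • H), fun H hH => ?_, ?_⟩
    · have h' := h (w.right • H) (fun h' => hH ((key H).1 h'))
      simp [h', vectorAct]
    · funext H
      simp [vectorAct]

/-- The action of `U ≀ Γ(K)` on the power complex, `F(ε) ↦ (φ F)(w ε)` for `w = (u, φ)`. -/
def powerAct {n : ℕ} {K : Type*} [PartialOrder K] {U : Subgroup (Equiv.Perm (Fin n))}
    (w : Wreath U K) : PowerComplex n K → PowerComplex n K :=
  WithBot.map fun p => ⟨(w.right p.1.1, vectorAct w '' p.1.2), by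
    obtain ⟨ε, hε⟩ := p.2
    exact ⟨vectorAct w ε, by rw [hε]; exact vectorAct_image w p.1.1 ε⟩⟩

/-!
The theorem is proved on the geometric side: the power complex is shown to be an incidence complex
with a flag-transitive action, and everything about the system of subgroups is read off from this
action.

Let a group `G` act flag-transitively on a finite incidence complex `P` of rank `m`, with base flag
`Ψ`, and let `S_I` be the stabilizer of the faces of `Ψ` whose ranks are not in `I`. Clearly
`S_I ∩ S_J = S_{I ∩ J}`, and strong flag-connectedness shows that `S_I` is generated by `S_∅` and
the `S_{i}` with `i ∈ I` (`flagStab_le_of_singletons`). So, if a system `R` satisfies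
`R (-1) = S_∅` and `R (-1) ⊔ R i = S_{i}`, then `Γ_I = S_I` for all `I`
(`genSubgroup_eq_flagStab`). This gives the intersection property at once, and it identifies the
`i`-faces of the coset complex, the cosets of the stabilizer of the `i`-face of `Ψ`, with the
`i`-faces of `P`; two faces are incident in `P` iff they lie in a common flag `g Ψ`, that is, iff
the cosets meet (`cosetComplexRecovers_of_genSubgroup_eq_flagStab`). The commutation property is
about the `R i` themselves and not about the `S_{i}`, and is verified separately.

For the power complex, a flag consists of the least face and the cells `F(ζ)`, with a vector `ζ` and
`F` in a flag of `K`. Flags with the same `ζ` are joined as in `K`, and the coordinate of `ζ` at a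
vertex can be changed in one step whenever this vertex belongs to the flag of `K`
(`strongly_flag_connected_powerComplex`). The intervals are those of `K`, except for the edges, which
have `n` vertices. Flag-transitivity of `U ≀ Γ(K)` follows from that of `Γ(K)` and transitivity of
`U`, and the stabilizers of subchains of the base flag `{∅} ∪ {F(o, …, o) : F ∈ Φ}` can be written
down explicitly (`mem_flagStab_powerHom_iff`). The cyclic case is the special case of a transitive
`U` with trivial point stabilizers (`cyclicSystem_eq_transitiveSystem`).
-/

/-! ### Ranks and flags in finite complexes -/

theorem Order.height_lt_top_of_finite {P : Type*} [PartialOrder P] [Finite P] (F : P) :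
    Order.height F < ⊤ := by
  have := Fintype.ofFinite P
  refine lt_of_le_of_lt (b := (Fintype.card P : ℕ∞)) ?_ (ENat.natCast_lt_top _)
  exact Order.height_le fun p _ => by exact_mod_cast p.length_lt_card.le

theorem faceRank_strictMono {P : Type*} [PartialOrder P] [Finite P] :
    StrictMono (faceRank : P → ℤ) := by
  intro x y hxy
  have h := Order.height_strictMono hxy (Order.height_lt_top_of_finite x)
  have h' : (Order.height x).toNat < (Order.height y).toNat := by
    rwa [← ENat.natCast_toNat (Order.height_lt_top_of_finite x).ne,
      ← ENat.natCast_toNat (Order.height_lt_top_of_finite y).ne, Nat.cast_lt] at h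
  simp only [faceRank]
  omega

theorem faceRank_orderIso {P Q : Type*} [PartialOrder P] [PartialOrder Q] (e : P ≃o Q) (F : P) :
    faceRank (e F) = faceRank F := by
  simp [faceRank]

theorem neg_one_le_faceRank {P : Type*} [PartialOrder P] (F : P) : -1 ≤ faceRank F := by
  simp only [faceRank]; omega

theorem faceRank_eq_neg_one_of_least {P : Type*} [PartialOrder P] {F : P} (hF : ∀ G, F ≤ G) :
    faceRank F = -1 := by
  have h : Order.height F = 0 := Order.height_eq_zero.2 fun G _ => hF G
  simp [faceRank, h]

theorem Flag.eq_of_subset {P : Type*} [PartialOrder P] {A B : Flag P}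
    (h : (A : Set P) ⊆ B) : A = B :=
  Flag.ext (A.maxChain.2 B.chain_le h)

theorem Flag.eq_of_faceRank_eq {P : Type*} [PartialOrder P] [Finite P] (A : Flag P) {F G : P}
    (hF : F ∈ A) (hG : G ∈ A) (h : faceRank F = faceRank G) : F = G := by
  rcases A.le_or_le hF hG with h' | h'
  · rcases h'.eq_or_lt with h' | h'
    · exact h'
    · exact absurd h (faceRank_strictMono h').ne
  · rcases h'.eq_or_lt with h' | h'
    · exact h'.symm
    · exact absurd h (faceRank_strictMono h').ne'

theorem Flag.le_of_faceRank_le {P : Type*} [PartialOrder P] [Finite P] (A : Flag P) {F G : P}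
    (hF : F ∈ A) (hG : G ∈ A) (h : faceRank F ≤ faceRank G) : F ≤ G := by
  rcases A.le_or_le hF hG with h' | h'
  · exact h'
  · exact (A.eq_of_faceRank_eq hF hG (h.antisymm (faceRank_strictMono.monotone h'))).le

theorem Flag.mem_of_forall_le {P : Type*} [PartialOrder P] (A : Flag P) {F : P}
    (h : ∀ G, F ≤ G) : F ∈ A :=
  Flag.mem_iff_forall_le_or_ge.2 fun _ _ => Or.inl (h _)

theorem Flag.mem_of_forall_ge {P : Type*} [PartialOrder P] (A : Flag P) {F : P}
    (h : ∀ G, G ≤ F) : F ∈ A :=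
  Flag.mem_iff_forall_le_or_ge.2 fun _ _ => Or.inr (h _)

theorem Flag.apply_mem_map {P Q : Type*} [PartialOrder P] [PartialOrder Q] (e : P ≃o Q)
    {A : Flag P} {F : P} (hF : F ∈ A) : e F ∈ Flag.map e A :=
  Set.mem_image_of_mem e hF

namespace IsIncidenceComplex

variable {P : Type*} [PartialOrder P] {m : ℕ}

theorem encard_flag (hP : IsIncidenceComplex m P) (A : Flag P) :
    (A : Set P).encard = m + 2 := by
  obtain ⟨B, hAB, hB⟩ := hP.chain_subset_flag A A.chain_le
  rw [Flag.eq_of_subset hAB, hB]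

theorem exists_flag (hP : IsIncidenceComplex m P) {C : Set P} (hC : IsChain (· ≤ ·) C) :
    ∃ A : Flag P, C ⊆ A :=
  (hP.chain_subset_flag C hC).imp fun _ h => h.1

theorem exists_mem_flag (hP : IsIncidenceComplex m P) (F : P) : ∃ A : Flag P, F ∈ A :=
  (hP.exists_flag (C := {F}) (by simp)).imp fun _ h => h rfl

theorem faceRank_le (hP : IsIncidenceComplex m P) (F : P) : faceRank F ≤ m := by
  have h : Order.height F ≤ (m + 1 : ℕ) := by
    refine Order.height_le fun p _ => ?_
    obtain ⟨A, hA⟩ := hP.exists_flag (C := Set.range p)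
      (p.monotone.isChain_range)
    have h1 := Set.encard_le_encard hA
    rw [hP.encard_flag, ← Set.image_univ, p.strictMono.injective.encard_image,
      Set.encard_univ, ENat.card_eq_coe_fintype_card, Fintype.card_fin] at h1
    norm_cast at h1 ⊢
    omega
  have h' := ENat.toNat_le_toNat h (ENat.natCast_ne_top _)
  rw [ENat.toNat_natCast] at h'
  simp only [faceRank]
  omega

/-- A flag of a complex of rank `m` has `m + 2` faces, whose ranks are distinct and lie between
`-1` and `m`; so each of these ranks occurs. -/
theorem exists_mem_faceRank_eq [Finite P] (hP : IsIncidenceComplex m P) (A : Flag P) {i : ℤ}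
    (hi : i ∈ Set.Icc (-1 : ℤ) m) : ∃ F ∈ A, faceRank F = i := by
  have hinj : Set.InjOn faceRank (A : Set P) := fun F hF G hG h => A.eq_of_faceRank_eq hF hG h
  have hsub : faceRank '' (A : Set P) ⊆ Set.Icc (-1 : ℤ) m := by
    rintro _ ⟨F, _, rfl⟩
    exact ⟨neg_one_le_faceRank F, hP.faceRank_le F⟩
  have hcard : (Set.Icc (-1 : ℤ) m).encard ≤ (faceRank '' (A : Set P)).encard := by
    rw [hinj.encard_image, hP.encard_flag, ← Finset.coe_Icc, Set.encard_coe_eq_coe_finsetCard,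
      Int.card_Icc]
    have : ((m : ℤ) + 1 - (-1)).toNat = m + 2 := by omega
    rw [this]
    norm_cast
  have heq := (Set.finite_Icc (-1 : ℤ) m).eq_of_subset_of_encard_le' hsub hcard
  rw [← heq] at hi
  exact hi

theorem faceRank_eq_of_greatest [Finite P] (hP : IsIncidenceComplex m P) {F : P}
    (hF : ∀ G, G ≤ F) : faceRank F = m := by
  obtain ⟨A, -⟩ := hP.exists_mem_flag F
  obtain ⟨G, -, hG⟩ := hP.exists_mem_faceRank_eq A (i := m) (by simp)
  exact (hP.faceRank_le F).antisymm (hG ▸ faceRank_strictMono.monotone (hF G))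

end IsIncidenceComplex

theorem FlagAdjacent.map {P Q : Type*} [PartialOrder P] [PartialOrder Q] (e : P ≃o Q)
    {A B : Flag P} (h : FlagAdjacent A B) : FlagAdjacent (Flag.map e A) (Flag.map e B) := by
  refine ⟨?_, ?_⟩
  · rw [Flag.coe_map, Flag.coe_map, ← Set.image_sdiff e.injective, e.injective.encard_image, h.1]
  · rw [Flag.coe_map, Flag.coe_map, ← Set.image_sdiff e.injective, e.injective.encard_image, h.2]

theorem IsIncidenceComplex.of_orderIso {P Q : Type*} [PartialOrder P] [PartialOrder Q] {m : ℕ}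
    (hP : IsIncidenceComplex m P) (e : P ≃o Q) : IsIncidenceComplex m Q where
  exists_least := by
    obtain ⟨F, hF⟩ := hP.exists_least
    exact ⟨e F, fun G => e.le_symm_apply.1 (hF _)⟩
  exists_greatest := by
    obtain ⟨F, hF⟩ := hP.exists_greatest
    exact ⟨e F, fun G => e.symm_apply_le.1 (hF _)⟩
  chain_subset_flag C hC := by
    obtain ⟨A, hA⟩ := hP.exists_flag (hC.image e.symm)
    refine ⟨Flag.map e A, fun x hx => ?_, ?_⟩
    · exact ⟨e.symm x, hA ⟨x, hx, rfl⟩, e.apply_symm_apply x⟩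
    · rw [Flag.coe_map, e.injective.encard_image, hP.encard_flag]
  strongly_flag_connected A B := by
    have h := hP.strongly_flag_connected (Flag.map e.symm A) (Flag.map e.symm B)
    have hback : ∀ X : Flag Q, Flag.map e (Flag.map e.symm X) = X := fun X =>
      (Flag.map e).apply_symm_apply X
    have hsub : ∀ X : Flag P, (Flag.map e.symm A : Set P) ∩ (Flag.map e.symm B : Set P) ⊆ X →
        (A : Set Q) ∩ (B : Set Q) ⊆ Flag.map e X := by
      intro X hX x hx
      exact ⟨e.symm x, hX ⟨⟨x, hx.1, rfl⟩, ⟨x, hx.2, rfl⟩⟩, e.apply_symm_apply x⟩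
    have h' := Relation.ReflTransGen.lift (r := fun X Y : Flag P => FlagAdjacent X Y ∧
        (Flag.map e.symm A : Set P) ∩ (Flag.map e.symm B : Set P) ⊆ (X : Set P) ∧
        (Flag.map e.symm A : Set P) ∩ (Flag.map e.symm B : Set P) ⊆ (Y : Set P)) (Flag.map e)
      (p := fun X Y : Flag Q => FlagAdjacent X Y ∧
        (A : Set Q) ∩ (B : Set Q) ⊆ (X : Set Q) ∧ (A : Set Q) ∩ (B : Set Q) ⊆ (Y : Set Q))
      (fun X Y hXY => ⟨hXY.1.map e, hsub X hXY.2.1, hsub Y hXY.2.2⟩) _ _ h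
    simp only [Function.onFun, hback] at h'
    exact h'
  homogeneous := by
    obtain ⟨c, hc⟩ := hP.homogeneous
    refine ⟨c, fun i h0 h1 => ⟨(hc i h0 h1).1, fun F G hF hG hFG => ?_⟩⟩
    rw [← (hc i h0 h1).2 (e.symm F) (e.symm G) (by rw [faceRank_orderIso, hF])
      (by rw [faceRank_orderIso, hG]) (e.symm.lt_iff_lt.2 hFG), ← e.injective.encard_image]
    congr 1
    ext H
    constructor
    · rintro ⟨h, h', h''⟩
      exact ⟨e.symm H, ⟨by rw [faceRank_orderIso, h], e.symm.lt_iff_lt.2 h',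
        e.symm.lt_iff_lt.2 h''⟩, e.apply_symm_apply H⟩
    · rintro ⟨H, ⟨h, h', h''⟩, rfl⟩
      exact ⟨by rw [faceRank_orderIso, h], e.symm_apply_lt.1 h', e.lt_symm_apply.1 h''⟩

/-! ### Stabilizers of subchains of a base flag -/

section FlagStab

variable {G P : Type*} [Group G] [PartialOrder P]

/-- The elements of `G` that fix each face of the flag `Ψ` whose rank is not in `I`. -/
def flagStab (ρ : G →* (P ≃o P)) (Ψ : Flag P) (I : Set ℤ) : Subgroup G where
  carrier := {g | ∀ F ∈ Ψ, faceRank F ∉ I → ρ g F = F}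
  one_mem' := fun F _ _ => by simp
  mul_mem' := fun {a b} ha hb F hF hi => by
    rw [map_mul, RelIso.mul_apply, hb F hF hi, ha F hF hi]
  inv_mem' := fun {a} ha F hF hi => by
    have h := congrArg (ρ a⁻¹) (ha F hF hi)
    rw [← RelIso.mul_apply, ← map_mul, inv_mul_cancel, map_one, RelIso.one_apply] at h
    exact h.symm

variable {ρ : G →* (P ≃o P)} {Ψ : Flag P}

theorem flagStab_mono {I J : Set ℤ} (h : I ⊆ J) : flagStab ρ Ψ I ≤ flagStab ρ Ψ J :=
  fun _ hg F hF hJ => hg F hF fun hI => hJ (h hI)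

theorem flagStab_inf (I J : Set ℤ) :
    flagStab ρ Ψ I ⊓ flagStab ρ Ψ J = flagStab ρ Ψ (I ∩ J) := by
  refine le_antisymm (fun g hg F hF h => ?_)
    (le_inf (flagStab_mono Set.inter_subset_left) (flagStab_mono Set.inter_subset_right))
  by_cases hI : faceRank F ∈ I
  · exact hg.2 F hF fun hJ => h ⟨hI, hJ⟩
  · exact hg.1 F hF hI

theorem map_mul_apply_face (ρ : G →* (P ≃o P)) (g h : G) (F : P) : ρ (g * h) F = ρ g (ρ h F) := by
  rw [map_mul, RelIso.mul_apply]

theorem map_inv_apply_face (ρ : G →* (P ≃o P)) (g : G) (F : P) : ρ g⁻¹ (ρ g F) = F := by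
  rw [← map_mul_apply_face, inv_mul_cancel, map_one, RelIso.one_apply]

theorem map_inv_mul_apply_eq_iff (ρ : G →* (P ≃o P)) (g h : G) (F E : P) :
    ρ (g⁻¹ * h) F = E ↔ ρ h F = ρ g E := by
  rw [map_mul_apply_face]
  constructor
  · rintro rfl
    have := map_inv_apply_face ρ g⁻¹ (ρ h F)
    rw [inv_inv] at this
    exact this.symm
  · intro h'
    rw [h', map_inv_apply_face]

/-- A face that lies in `Ψ` and in `g Ψ` is fixed by `g`, since `g` preserves ranks. -/
theorem apply_eq_of_mem_map [Finite P] {g : G} {F : P} (hF : F ∈ Ψ)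
    (h : F ∈ Flag.map (ρ g) Ψ) : ρ g F = F := by
  obtain ⟨E, hE, hEF⟩ := h
  have : E = F := Ψ.eq_of_faceRank_eq hE hF (by rw [← faceRank_apply (ρ g) E, hEF])
  rwa [this] at hEF

/-- The generation theorem: by strong flag-connectedness, the stabilizer of a subchain of the base
flag is generated by the stabilizers of the base flag with one of the other faces removed. A
sequence of adjacent flags from `Ψ` to `g Ψ` is followed step by step: a flag that is adjacent to
`h Ψ` has the form `h x Ψ`, where `x` fixes all faces of `Ψ` but one. -/
theorem flagStab_le_of_singletons [Finite P] {m : ℕ} (hP : IsIncidenceComplex m P)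
    (hρ : FlagTransitive ρ) {I : Set ℤ} {H : Subgroup G}
    (h0 : flagStab ρ Ψ ∅ ≤ H) (hI : ∀ i ∈ I, flagStab ρ Ψ {i} ≤ H) :
    flagStab ρ Ψ I ≤ H := by
  intro g hg
  have key : ∀ X : Flag P, Relation.ReflTransGen
      (fun A B : Flag P => FlagAdjacent A B ∧
        (Ψ : Set P) ∩ (Flag.map (ρ g) Ψ : Set P) ⊆ (A : Set P) ∧
        (Ψ : Set P) ∩ (Flag.map (ρ g) Ψ : Set P) ⊆ (B : Set P)) Ψ X →
      ∃ h ∈ H, Flag.map (ρ h) Ψ = X := by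
    intro X hX
    induction hX with
    | refl => exact ⟨1, one_mem H, Flag.ext (by simp)⟩
    | @tail A B _ hstep ih =>
      obtain ⟨h, hh, rfl⟩ := ih
      obtain ⟨b, rfl⟩ := hρ Ψ B
      obtain ⟨⟨hadj, -⟩, hA, hB⟩ := hstep
      obtain ⟨F, hF⟩ := Set.encard_eq_one.1 hadj
      have hFm : F ∈ (Flag.map (ρ h) Ψ : Set P) \ (Flag.map (ρ b) Ψ : Set P) := by
        rw [hF]; rfl
      obtain ⟨⟨E, hE, rfl⟩, hFB⟩ := hFm
      have hiI : faceRank E ∈ I := by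
        by_contra hi
        have hgE : E ∈ Flag.map (ρ g) Ψ := ⟨E, hE, hg E hE hi⟩
        have hEA : E ∈ Flag.map (ρ h) Ψ := hA ⟨hE, hgE⟩
        have hEB : E ∈ Flag.map (ρ b) Ψ := hB ⟨hE, hgE⟩
        rw [apply_eq_of_mem_map hE hEA] at hFB
        exact hFB hEB
      have hx : h⁻¹ * b ∈ flagStab ρ Ψ {faceRank E} := by
        intro D hD hDi
        rw [map_inv_mul_apply_eq_iff]
        have hDB : ρ h D ∈ Flag.map (ρ b) Ψ := by
          by_contra hDB
          have : ρ h D ∈ ({ρ h E} : Set P) := by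
            rw [← hF]; exact ⟨Flag.apply_mem_map _ hD, hDB⟩
          exact hDi (congrArg faceRank ((ρ h).injective this))
        obtain ⟨D', hD', hDD'⟩ := hDB
        have : D' = D := Ψ.eq_of_faceRank_eq hD' hD
          (by rw [← faceRank_apply (ρ b) D', ← faceRank_apply (ρ h) D, hDD'])
        rw [← hDD', this]
      refine ⟨b, ?_, rfl⟩
      have := H.mul_mem hh (hI _ hiI hx)
      rwa [mul_inv_cancel_left] at this
  obtain ⟨h, hh, hhg⟩ := key _ (hP.strongly_flag_connected Ψ (Flag.map (ρ g) Ψ))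
  have hx : h⁻¹ * g ∈ flagStab ρ Ψ ∅ := by
    intro F hF _
    rw [map_inv_mul_apply_eq_iff]
    have hm : ρ g F ∈ Flag.map (ρ h) Ψ := hhg ▸ Flag.apply_mem_map _ hF
    obtain ⟨E, hE, hEF⟩ := hm
    have : E = F := Ψ.eq_of_faceRank_eq hE hF
      (by rw [← faceRank_apply (ρ h) E, ← faceRank_apply (ρ g) F, hEF])
    rw [← hEF, this]
  have := H.mul_mem hh (h0 hx)
  rwa [mul_inv_cancel_left] at this

/-- Every automorphism fixes the least face. -/
theorem flagStab_neg_one [Finite P] {m : ℕ} (hP : IsIncidenceComplex m P) :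
    flagStab ρ Ψ {-1} = flagStab ρ Ψ ∅ := by
  refine le_antisymm (fun g hg F hF _ => ?_) (flagStab_mono (Set.empty_subset _))
  by_cases h : faceRank F = -1
  · obtain ⟨E, hE⟩ := hP.exists_least
    have := Ψ.eq_of_faceRank_eq hF (Ψ.mem_of_forall_le hE)
      (h.trans (faceRank_eq_neg_one_of_least hE).symm)
    subst this
    exact ((ρ g).le_symm_apply.1 (hE _)).antisymm (hE _)
  · exact hg F hF h

/-- Every automorphism fixes the greatest face. -/
theorem flagStab_top [Finite P] {m : ℕ} (hP : IsIncidenceComplex m P) :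
    flagStab ρ Ψ {(m : ℤ)} = flagStab ρ Ψ ∅ := by
  refine le_antisymm (fun g hg F hF _ => ?_) (flagStab_mono (Set.empty_subset _))
  by_cases h : faceRank F = m
  · obtain ⟨E, hE⟩ := hP.exists_greatest
    have := Ψ.eq_of_faceRank_eq hF (Ψ.mem_of_forall_ge hE)
      (h.trans (hP.faceRank_eq_of_greatest hE).symm)
    subst this
    exact (hE _).antisymm ((ρ g).symm_apply_le.1 (hE _))
  · exact hg F hF h

/-- If `i` and `j` differ by at least two, the `i`-face and the `j`-face of the base flag can be
moved independently of each other. -/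
theorem flagStab_pair_mul [Finite P] {m : ℕ} (hP : IsIncidenceComplex m P)
    (hρ : FlagTransitive ρ) {i j : ℤ} (hi : -1 ≤ i) (hij : i < j - 1) (hj : j ≤ m) :
    (flagStab ρ Ψ {i} : Set G) * (flagStab ρ Ψ {j} : Set G) = flagStab ρ Ψ {i, j} := by
  apply Set.Subset.antisymm
  · rintro _ ⟨a, ha, b, hb, rfl⟩
    exact mul_mem (flagStab_mono (by simp) ha) (flagStab_mono (by simp) hb)
  intro g hg
  obtain ⟨Fi, hFi, hFir⟩ := hP.exists_mem_faceRank_eq Ψ (i := i) ⟨hi, by omega⟩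
  obtain ⟨Fs, hFs, hFsr⟩ := hP.exists_mem_faceRank_eq Ψ (i := i + 1) ⟨by omega, by omega⟩
  have hgs : ρ g Fs = Fs := hg Fs hFs (by simp; omega)
  have hle : ρ g Fi ≤ Fs := by
    rw [← hgs]
    exact (ρ g).monotone (Ψ.le_of_faceRank_le hFi hFs (by omega))
  -- replacing the `i`-face of `Ψ` by its image under `g` gives a chain
  have hchain : IsChain (· ≤ ·) (insert (ρ g Fi) {F | F ∈ Ψ ∧ faceRank F ≠ i}) := by
    refine IsChain.insert (fun x hx y hy => Ψ.chain_le hx.1 hy.1) fun F hF _ => ?_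
    obtain ⟨hF, hFr⟩ := hF
    by_cases hFj : faceRank F = j
    · exact Or.inl (hle.trans (Ψ.le_of_faceRank_le hFs hF (by omega)))
    · have hgF : ρ g F = F := hg F hF (by simp [hFr, hFj])
      rw [← hgF, (ρ g).le_iff_le, (ρ g).le_iff_le]
      exact Ψ.le_or_le hFi hF
  obtain ⟨A, hA⟩ := hP.exists_flag hchain
  obtain ⟨a, rfl⟩ := hρ Ψ A
  have ha : a ∈ flagStab ρ Ψ {i} := fun F hF hFr =>
    apply_eq_of_mem_map hF (hA (Or.inr ⟨hF, hFr⟩))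
  have hai : ρ a Fi = ρ g Fi := by
    obtain ⟨E, hE, hEF⟩ := hA (Or.inl rfl)
    have : E = Fi := Ψ.eq_of_faceRank_eq hE hFi
      (by rw [← faceRank_apply (ρ a) E, ← faceRank_apply (ρ g) Fi, hEF])
    rw [← hEF, this]
  refine ⟨a, ha, a⁻¹ * g, fun F hF hFj => ?_, mul_inv_cancel_left a g⟩
  rw [map_inv_mul_apply_eq_iff]
  by_cases hFr : faceRank F = i
  · rw [Ψ.eq_of_faceRank_eq hF hFi (hFr.trans hFir.symm), hai]
  · rw [ha F hF hFr]
    exact hg F hF (by simpa [hFr] using hFj)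

end FlagStab

/-! ### Commuting products of subgroups -/

theorem Subgroup.mul_comm_of_mul_eq {G : Type*} [Group G] {A B C : Subgroup G}
    (h : (A : Set G) * (B : Set G) = C) : (A : Set G) * (B : Set G) = (B : Set G) * (A : Set G) := by
  rw [h, ← inv_coe_set (H := C), ← h, mul_inv_rev, inv_coe_set, inv_coe_set]

theorem Subgroup.mul_comm_of_subset {G : Type*} [Group G] {A B : Subgroup G}
    (h : (A : Set G) * (B : Set G) ⊆ (B : Set G) * (A : Set G)) :
    (A : Set G) * (B : Set G) = (B : Set G) * (A : Set G) := by
  refine h.antisymm ?_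
  have h' := Set.inv_subset_inv.2 h
  rwa [mul_inv_rev, mul_inv_rev, inv_coe_set, inv_coe_set] at h'

/-! ### Recovering a complex from a system of subgroups -/

section Recover

variable {G P : Type*} [Group G] [PartialOrder P] {m : ℕ} {R : ℤ → Subgroup G}
  {ρ : G →* (P ≃o P)} {Ψ : Flag P}

/-- If, up to the stabilizer `R (-1)` of the base flag, the `R i` are the stabilizers of the base
flag with its `i`-face removed, then the groups `Γ_I` are the stabilizers of the subchains. -/
theorem genSubgroup_eq_flagStab [Finite P] (hP : IsIncidenceComplex m P) (hρ : FlagTransitive ρ)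
    (h0 : R (-1) = flagStab ρ Ψ ∅)
    (hle : ∀ i ∈ Set.Icc (-1 : ℤ) m, R i ≤ flagStab ρ Ψ {i})
    (hge : ∀ i ∈ Set.Icc (-1 : ℤ) m, flagStab ρ Ψ {i} ≤ R (-1) ⊔ R i)
    {I : Set ℤ} (hI : I ⊆ Set.Icc (-1 : ℤ) m) :
    genSubgroup R I = flagStab ρ Ψ I := by
  apply le_antisymm
  · refine sup_le (h0.le.trans (flagStab_mono (Set.empty_subset _))) (iSup₂_le fun i hi => ?_)
    exact (hle i (hI hi)).trans (flagStab_mono (by simpa using hi))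
  · refine flagStab_le_of_singletons hP hρ (h0.ge.trans le_sup_left) fun i hi => ?_
    exact (hge i (hI hi)).trans (sup_le_sup_left (le_iSup₂ (f := fun i _ => R i) i hi) _)

theorem flagStab_Icc (hP : IsIncidenceComplex m P) :
    flagStab ρ Ψ (Set.Icc (-1 : ℤ) m) = ⊤ :=
  eq_top_iff.2 fun _ _ F _ hF => (hF ⟨neg_one_le_faceRank F, hP.faceRank_le F⟩).elim

theorem isDistinguishedSystem_of_genSubgroup_eq_flagStab (hP : IsIncidenceComplex m P)
    (hends : R (-1) = R m)
    (hgen : ∀ I ⊆ Set.Icc (-1 : ℤ) m, genSubgroup R I = flagStab ρ Ψ I)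
    (hcomm : ∀ i j : ℤ, -1 ≤ i → i < j - 1 → j ≤ m →
      (R i : Set G) * (R j : Set G) = (R j : Set G) * (R i : Set G)) :
    IsDistinguishedSystem m R where
  ends_eq := hends
  generate := by
    have h := hgen _ subset_rfl
    rw [flagStab_Icc hP] at h
    rw [eq_top_iff, ← h]
    exact sup_le (le_iSup₂ (f := fun i _ => R i) (-1) (by simp)) le_rfl
  commute := hcomm
  inter I J hI hJ := by
    rw [hgen I hI, hgen J hJ, hgen _ (Set.inter_subset_left.trans hI), flagStab_inf]

/-- Fixing the `i`-face of the base flag is membership in the stabilizer of this one face. -/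
theorem mem_flagStab_compl_singleton [Finite P] {i : ℤ} {F : P} (hP : IsIncidenceComplex m P)
    (hF : F ∈ Ψ) (hi : faceRank F = i) {g : G} :
    g ∈ flagStab ρ Ψ (Set.Icc (-1 : ℤ) m \ {i}) ↔ ρ g F = F := by
  constructor
  · intro h
    exact h F hF (by simp [hi])
  · intro h E hE hEi
    have : faceRank E = i := by
      by_contra hne
      exact hEi ⟨⟨neg_one_le_faceRank E, hP.faceRank_le E⟩, hne⟩
    rwa [Ψ.eq_of_faceRank_eq hE hF (this.trans hi.symm)]

/-- A complex with a flag-transitive group is the coset complex of its stabilizers: the coset of `g`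
of index `i` corresponds to the image under `g` of the `i`-face of the base flag. -/
theorem cosetComplexRecovers_of_genSubgroup_eq_flagStab [Finite P] (hP : IsIncidenceComplex m P)
    (hρ : FlagTransitive ρ) (hinj : Function.Injective ρ)
    (hgen : ∀ I ⊆ Set.Icc (-1 : ℤ) m, genSubgroup R I = flagStab ρ Ψ I)
    {α : G → P → P} (hα : ∀ g x, ρ g x = α g x) :
    CosetComplexRecovers m R P α := by
  classical
  have : Nonempty P := ⟨hP.exists_least.choose⟩
  choose! b hbΨ hbr using fun i (hi : i ∈ Set.Icc (-1 : ℤ) m) => hP.exists_mem_faceRank_eq Ψ hi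
  have hcoset : ∀ i ∈ Set.Icc (-1 : ℤ) m, ∀ g h : G,
      (QuotientGroup.mk g : G ⧸ genSubgroup R (Set.Icc (-1 : ℤ) m \ {i})) = QuotientGroup.mk h ↔
        ρ g (b i) = ρ h (b i) := by
    intro i hi g h
    rw [QuotientGroup.eq, hgen _ Set.sdiff_subset, mem_flagStab_compl_singleton hP (hbΨ i hi)
      (hbr i hi), map_inv_mul_apply_eq_iff, eq_comm]
  let f : CosetFace m R → P := fun x => ρ (Quotient.out x.coset) (b x.idx)
  have hf : ∀ i (hi : i ∈ Set.Icc (-1 : ℤ) m) (g : G),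
      f ⟨i, hi, QuotientGroup.mk g⟩ = ρ g (b i) := fun i hi g =>
    (hcoset i hi _ g).1 (QuotientGroup.out_eq' _)
  have hrank : ∀ x, faceRank (f x) = x.idx := fun x => by
    simp only [f]
    rw [faceRank_apply, hbr _ x.idx_mem]
  have hfinj : Function.Injective f := by
    rintro ⟨i, hi, c⟩ ⟨j, hj, d⟩ h
    have hij : i = j := by
      have := congrArg faceRank h
      rwa [hrank, hrank] at this
    subst hij
    obtain ⟨g, rfl⟩ := QuotientGroup.mk_surjective c
    obtain ⟨g', rfl⟩ := QuotientGroup.mk_surjective d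
    rw [hf, hf] at h
    rw [(hcoset i hi g g').2 h]
  have hfsurj : Function.Surjective f := by
    intro F
    obtain ⟨A, hA⟩ := hP.exists_mem_flag F
    obtain ⟨g, rfl⟩ := hρ Ψ A
    obtain ⟨E, hE, rfl⟩ := hA
    have hi : faceRank E ∈ Set.Icc (-1 : ℤ) m := ⟨neg_one_le_faceRank E, hP.faceRank_le E⟩
    refine ⟨⟨faceRank E, hi, QuotientGroup.mk g⟩, ?_⟩
    rw [hf, Ψ.eq_of_faceRank_eq (hbΨ _ hi) hE (hbr _ hi)]
  let _ : PartialOrder (CosetFace m R) := PartialOrder.lift f hfinj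
  let e : CosetFace m R ≃o P :=
    { Equiv.ofBijective f ⟨hfinj, hfsurj⟩ with map_rel_iff' := Iff.rfl }
  have hef : ∀ x, e x = f x := fun _ => rfl
  have hetr : ∀ g x, e (x.translate g) = ρ g (e x) := by
    rintro g ⟨i, hi, c⟩
    obtain ⟨g', rfl⟩ := QuotientGroup.mk_surjective c
    rw [hef, hef, hf, ← map_mul_apply_face]
    exact hf i hi (g * g')
  let ρ' : G →* (CosetFace m R ≃o CosetFace m R) :=
    { toFun := fun g => (e.trans (ρ g)).trans e.symm
      map_one' := by ext x; simp
      map_mul' := fun g h => by ext x; simp }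
  have hρ'e : ∀ g x, e (ρ' g x) = ρ g (e x) := fun g x => e.apply_symm_apply _
  have htr : FlagTransitive ρ' := by
    intro A B
    obtain ⟨g, hg⟩ := hρ (Flag.map e A) (Flag.map e B)
    refine ⟨g, (Flag.map e).injective (Flag.ext ?_)⟩
    rw [← hg]
    simp only [Flag.coe_map, Set.image_image, hρ'e]
  refine ⟨inferInstance, fun x y => ?_, hP.of_orderIso e.symm, fun A B => ?_, ρ', fun g x => ?_,
    fun g h hgh => hinj ?_, htr, e, fun g x => (hρ'e g x).trans (hα g _)⟩
  · -- two incident faces lie in a common flag, which is the image of the base flag under some `g`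
    constructor
    · intro hxy
      have hle : f x ≤ f y := hxy
      obtain ⟨A, hA⟩ := hP.exists_flag (C := {f x, f y}) (by
        intro u hu v hv _
        rcases hu with rfl | rfl <;> rcases hv with rfl | rfl <;> simp [hle])
      obtain ⟨g, rfl⟩ := hρ Ψ A
      have hmem : ∀ z : CosetFace m R, f z ∈ Flag.map (ρ g) Ψ → QuotientGroup.mk g = z.coset := by
        rintro ⟨i, hi, c⟩ ⟨E, hE, hEz⟩
        obtain ⟨g', rfl⟩ := QuotientGroup.mk_surjective c
        have hEr : faceRank E = i := by
          rw [← faceRank_apply (ρ g) E]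
          exact (congrArg faceRank hEz).trans (hrank _)
        rw [hf] at hEz
        rw [hcoset i hi, ← hEz, Ψ.eq_of_faceRank_eq (hbΨ _ hi) hE ((hbr _ hi).trans hEr.symm)]
      refine ⟨?_, g, hmem x (hA (by simp)), hmem y (hA (by simp))⟩
      rw [← hrank x, ← hrank y]
      exact faceRank_strictMono.monotone hle
    · rcases x with ⟨i, hi, c⟩
      rcases y with ⟨j, hj, d⟩
      rintro ⟨hij, g, hc, hd⟩
      obtain rfl : QuotientGroup.mk g = c := hc
      obtain rfl : QuotientGroup.mk g = d := hd
      change f _ ≤ f _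
      rw [hf, hf]
      have hij : i ≤ j := hij
      exact (ρ g).monotone (Ψ.le_of_faceRank_le (hbΨ i hi) (hbΨ j hj)
        (by rw [hbr i hi, hbr j hj]; exact hij))
  · obtain ⟨g, hg⟩ := htr A B
    exact ⟨ρ' g, hg⟩
  · exact e.injective ((hρ'e g x).trans (hetr g x).symm)
  · ext F
    have := congrArg (fun r : CosetFace m R ≃o CosetFace m R => e (r (e.symm F))) hgh
    simpa only [hρ'e, e.apply_symm_apply] using this

end Recover

/-! ### The power complex -/

section Power

variable {n : ℕ} {K : Type*} [PartialOrder K]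

instance [Finite K] : Finite (Vertex K) :=
  inferInstanceAs (Finite {F : K // faceRank F = 0})

/-- The face `F(ζ)` of the power complex. -/
def powerFace (F : K) (ζ : Vertex K → Fin n) : PowerComplex n K :=
  ((⟨(F, powerCell F ζ), ζ, rfl⟩ : ProperPowerFace n K) : WithBot (ProperPowerFace n K))

theorem eq_bot_or_eq_powerFace (x : PowerComplex n K) : x = ⊥ ∨ ∃ F ζ, x = powerFace F ζ := by
  induction x using WithBot.recBotCoe with
  | bot => exact Or.inl rfl
  | coe p =>
    obtain ⟨⟨F, S⟩, ζ, hζ⟩ := p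
    obtain rfl : S = powerCell F ζ := hζ
    exact Or.inr ⟨F, ζ, rfl⟩

theorem powerFace_ne_bot (F : K) (ζ : Vertex K → Fin n) : powerFace F ζ ≠ ⊥ :=
  WithBot.coe_ne_bot

theorem mem_powerCell_self (F : K) (ζ : Vertex K → Fin n) : ζ ∈ powerCell F ζ :=
  fun _ _ => rfl

theorem powerFace_le_iff {F G : K} {ζ η : Vertex K → Fin n} :
    powerFace F ζ ≤ powerFace G η ↔ F ≤ G ∧ ∀ H : Vertex K, ¬ H.1 ≤ G → ζ H = η H := by
  have h : powerFace F ζ ≤ powerFace G η ↔ F ≤ G ∧ powerCell F ζ ⊆ powerCell G η :=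
    WithBot.coe_le_coe
  rw [h]
  refine and_congr_right fun hFG => ⟨fun hs => hs (mem_powerCell_self F ζ), fun hs ξ hξ H hH => ?_⟩
  rw [hξ H fun hHF => hH (le_trans hHF hFG), hs H hH]

theorem powerFace_eq_iff {F G : K} {ζ η : Vertex K → Fin n} :
    powerFace F ζ = powerFace G η ↔ F = G ∧ ∀ H : Vertex K, ¬ H.1 ≤ G → ζ H = η H := by
  constructor
  · intro h
    have h1 := powerFace_le_iff.1 h.le
    exact ⟨h1.1.antisymm (powerFace_le_iff.1 h.ge).1, h1.2⟩
  · rintro ⟨rfl, h⟩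
    exact (powerFace_le_iff.2 ⟨le_rfl, h⟩).antisymm
      (powerFace_le_iff.2 ⟨le_rfl, fun H hH => (h H hH).symm⟩)

theorem powerFace_strictMono (ζ : Vertex K → Fin n) :
    StrictMono fun F : K => powerFace F ζ := by
  intro F G h
  refine lt_of_le_of_ne (powerFace_le_iff.2 ⟨h.le, fun _ _ => rfl⟩) fun he => ?_
  exact h.ne (powerFace_eq_iff.1 he).1

theorem powerFace_lt_powerFace_same {F G : K} {ζ : Vertex K → Fin n} :
    powerFace F ζ < powerFace G ζ ↔ F < G := by
  refine ⟨fun h => lt_of_le_of_ne (powerFace_le_iff.1 h.le).1 ?_, fun h => powerFace_strictMono ζ h⟩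
  rintro rfl
  exact h.ne rfl

theorem powerFace_injective (ζ : Vertex K → Fin n) :
    Function.Injective fun F : K => powerFace F ζ :=
  fun _ _ h => (powerFace_eq_iff.1 h).1

theorem faceRank_bot_powerComplex : faceRank (⊥ : PowerComplex n K) = -1 :=
  faceRank_eq_neg_one_of_least fun _ => bot_le

/-- The height of `F(ζ)` exceeds that of `F` by one, because of the additional least face. -/
theorem faceRank_powerFace [Finite K] (F : K) (ζ : Vertex K → Fin n) :
    faceRank (powerFace F ζ) = faceRank F + 1 := by
  have hle : Order.height (⟨(F, powerCell F ζ), ζ, rfl⟩ : ProperPowerFace n K) =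
      Order.height F := by
    refine le_antisymm ?_ ?_
    · refine Order.height_le_height_apply_of_strictMono (fun p : ProperPowerFace n K => p.1.1)
        (fun p q hpq => ?_) _
      have hpq' : (p : WithBot (ProperPowerFace n K)) < (q : WithBot (ProperPowerFace n K)) :=
        WithBot.coe_lt_coe.2 hpq
      obtain ⟨⟨F, S⟩, ζ, hζ⟩ := p
      obtain ⟨⟨G, T⟩, η, hη⟩ := q
      obtain rfl : S = powerCell F ζ := hζ
      obtain rfl : T = powerCell G η := hη
      have h1 := powerFace_le_iff.1 (hpq'.le : powerFace F ζ ≤ powerFace G η)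
      refine lt_of_le_of_ne h1.1 fun h => ?_
      exact hpq'.ne (powerFace_eq_iff.2 ⟨h, h1.2⟩)
    · refine Order.height_le_height_apply_of_strictMono
        (fun F : K => (⟨(F, powerCell F ζ), ζ, rfl⟩ : ProperPowerFace n K)) (fun F G h => ?_) F
      exact WithBot.coe_lt_coe.1 (powerFace_strictMono ζ h)
  have h2 : Order.height (powerFace F ζ) = Order.height F + 1 := by
    rw [← hle]
    exact Order.height_coe_withBot _
  rw [faceRank, h2, ENat.toNat_add (Order.height_lt_top_of_finite F).ne (by simp), faceRank]
  simp

theorem exists_eq_powerFace_of_faceRank [Finite K] {x : PowerComplex n K} {i : ℤ}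
    (hx : faceRank x = i) (hi : 0 ≤ i) : ∃ F ζ, faceRank F = i - 1 ∧ x = powerFace F ζ := by
  obtain rfl | ⟨F, ζ, rfl⟩ := eq_bot_or_eq_powerFace x
  · rw [faceRank_bot_powerComplex] at hx
    omega
  · rw [faceRank_powerFace] at hx
    exact ⟨F, ζ, by omega, rfl⟩

/-! ### Flags of the power complex -/

/-- The flag of the power complex that consists of the least face and the faces `F(ζ)`, where `F`
runs through a flag of `K`. -/
def powerFlag (A : Flag K) (ζ : Vertex K → Fin n) : Flag (PowerComplex n K) where
  carrier := insert ⊥ ((fun F => powerFace F ζ) '' (A : Set K))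
  Chain' := by
    refine IsChain.insert ?_ fun _ _ _ => Or.inl bot_le
    exact A.chain_le.image_of_map_rel _ _ _ fun F G h => (powerFace_strictMono ζ).monotone h
  max_chain' := by
    intro X hX hsub
    refine hsub.antisymm fun x hx => ?_
    obtain rfl | ⟨F, η, rfl⟩ := eq_bot_or_eq_powerFace x
    · exact Or.inl rfl
    have hF : F ∈ A := Flag.mem_iff_forall_le_or_ge.2 fun G hG =>
      (hX.total hx (hsub (Or.inr ⟨G, hG, rfl⟩))).imp (fun h => (powerFace_le_iff.1 h).1)
        fun h => (powerFace_le_iff.1 h).1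
    refine Or.inr ⟨F, hF, ?_⟩
    rcases hX.total hx (hsub (Or.inr ⟨F, hF, rfl⟩)) with h | h
    · exact powerFace_eq_iff.2 ⟨rfl, fun H hH => ((powerFace_le_iff.1 h).2 H hH).symm⟩
    · exact powerFace_eq_iff.2 ⟨rfl, (powerFace_le_iff.1 h).2⟩

theorem coe_powerFlag (A : Flag K) (ζ : Vertex K → Fin n) :
    (powerFlag A ζ : Set (PowerComplex n K)) = insert ⊥ ((fun F => powerFace F ζ) '' (A : Set K)) :=
  rfl

theorem bot_mem_powerFlag (A : Flag K) (ζ : Vertex K → Fin n) : ⊥ ∈ powerFlag A ζ :=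
  Or.inl rfl

theorem powerFace_mem_powerFlag {A : Flag K} {ζ : Vertex K → Fin n} {F : K} (hF : F ∈ A) :
    powerFace F ζ ∈ powerFlag A ζ :=
  Or.inr ⟨F, hF, rfl⟩

theorem powerFace_mem_powerFlag_iff {A : Flag K} {ζ η : Vertex K → Fin n} {F : K} :
    powerFace F η ∈ powerFlag A ζ ↔ F ∈ A ∧ ∀ H : Vertex K, ¬ H.1 ≤ F → ζ H = η H := by
  constructor
  · rintro (h | ⟨G, hG, h⟩)
    · exact absurd h (powerFace_ne_bot F η)
    · obtain ⟨rfl, h'⟩ := powerFace_eq_iff.1 h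
      exact ⟨hG, h'⟩
  · rintro ⟨hF, h⟩
    exact Or.inr ⟨F, hF, powerFace_eq_iff.2 ⟨rfl, h⟩⟩

theorem exists_subset_powerFlag [Finite K] {k : ℕ} (hK : IsIncidenceComplex k K) (hn : 0 < n)
    {C : Set (PowerComplex n K)} (hC : IsChain (· ≤ ·) C) :
    ∃ (A : Flag K) (ζ : Vertex K → Fin n), C ⊆ (powerFlag A ζ : Set (PowerComplex n K)) := by
  -- a vector that lies in the smallest face of `C` other than the least one lies in all of them
  obtain ⟨ζ, hζ⟩ : ∃ ζ : Vertex K → Fin n, ∀ F η, powerFace F η ∈ C →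
      ∀ H : Vertex K, ¬ H.1 ≤ F → ζ H = η H := by
    rcases (C \ {⊥}).eq_empty_or_nonempty with h | h
    · refine ⟨fun _ => ⟨0, hn⟩, fun F η hF => ?_⟩
      have : powerFace F η ∈ C \ {⊥} := ⟨hF, powerFace_ne_bot F η⟩
      rw [h] at this
      exact this.elim
    · obtain ⟨x, hx⟩ := (Set.toFinite (C \ {⊥})).exists_minimal h
      obtain rfl | ⟨F₀, ζ, rfl⟩ := eq_bot_or_eq_powerFace x
      · exact (hx.prop.2 rfl).elim
      refine ⟨ζ, fun F η hF => ?_⟩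
      have hle : powerFace F₀ ζ ≤ powerFace F η := by
        rcases hC.total hx.prop.1 hF with h' | h'
        · exact h'
        · exact hx.le_of_le ⟨hF, powerFace_ne_bot F η⟩ h'
      exact (powerFace_le_iff.1 hle).2
  have hchain : IsChain (· ≤ ·) {F : K | powerFace F ζ ∈ C} := by
    intro F hF G hG _
    exact (hC.total hF hG).imp (fun h => (powerFace_le_iff.1 h).1) fun h => (powerFace_le_iff.1 h).1
  obtain ⟨A, hA⟩ := hK.exists_flag hchain
  refine ⟨A, ζ, fun x hx => ?_⟩
  obtain rfl | ⟨F, η, rfl⟩ := eq_bot_or_eq_powerFace x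
  · exact bot_mem_powerFlag A ζ
  · have h := hζ F η hx
    refine powerFace_mem_powerFlag_iff.2 ⟨hA ?_, h⟩
    change powerFace F ζ ∈ C
    rwa [powerFace_eq_iff.2 ⟨rfl, h⟩]

theorem exists_eq_powerFlag [Finite K] {k : ℕ} (hK : IsIncidenceComplex k K) (hn : 0 < n)
    (X : Flag (PowerComplex n K)) : ∃ A ζ, X = powerFlag A ζ := by
  obtain ⟨A, ζ, h⟩ := exists_subset_powerFlag hK hn X.chain_le
  exact ⟨A, ζ, Flag.eq_of_subset h⟩

theorem encard_powerFlag {k : ℕ} (hK : IsIncidenceComplex k K) (A : Flag K)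
    (ζ : Vertex K → Fin n) : (powerFlag A ζ : Set (PowerComplex n K)).encard = (k + 1 : ℕ) + 2 := by
  rw [coe_powerFlag, Set.encard_insert_of_notMem, (powerFace_injective ζ).encard_image,
    hK.encard_flag]
  · push_cast
    ring
  · rintro ⟨F, _, h⟩
    exact powerFace_ne_bot F ζ h

/-! ### Strong flag-connectedness of the power complex -/

theorem FlagAdjacent.map_powerFlag {A B : Flag K} (h : FlagAdjacent A B) (ζ : Vertex K → Fin n) :
    FlagAdjacent (powerFlag A ζ) (powerFlag B ζ) := by
  have key : ∀ A B : Flag K, (powerFlag A ζ : Set (PowerComplex n K)) \ powerFlag B ζ =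
      (fun F => powerFace F ζ) '' ((A : Set K) \ B) := by
    intro A B
    ext x
    obtain rfl | ⟨F, η, rfl⟩ := eq_bot_or_eq_powerFace x
    · constructor
      · exact fun h => (h.2 (bot_mem_powerFlag B ζ)).elim
      · rintro ⟨F, _, h⟩
        exact (powerFace_ne_bot F ζ h).elim
    · constructor
      · rintro ⟨h1, h2⟩
        have h1' := powerFace_mem_powerFlag_iff.1 h1
        exact ⟨F, ⟨h1'.1, fun hF => h2 (powerFace_mem_powerFlag_iff.2 ⟨hF, h1'.2⟩)⟩,
          powerFace_eq_iff.2 ⟨rfl, h1'.2⟩⟩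
      · rintro ⟨G, ⟨hG, hG'⟩, h⟩
        rw [← h]
        exact ⟨powerFace_mem_powerFlag hG, fun h' => hG' (powerFace_mem_powerFlag_iff.1 h').1⟩
  rw [FlagAdjacent, key, key, (powerFace_injective ζ).encard_image,
    (powerFace_injective ζ).encard_image]
  exact h

/-- Changing the vector in the coordinate of the vertex of the flag only changes the vertex of the
flag of the power complex. -/
theorem flagAdjacent_powerFlag_of_vertex_mem [Finite K] {k : ℕ} (hK : IsIncidenceComplex k K)
    {A : Flag K} {H : Vertex K} (hH : H.1 ∈ A) {ζ η : Vertex K → Fin n} (hne : ζ H ≠ η H)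
    (heq : ∀ H', H' ≠ H → ζ H' = η H') : FlagAdjacent (powerFlag A ζ) (powerFlag A η) := by
  obtain ⟨L, hL⟩ := hK.exists_least
  have hLr := faceRank_eq_neg_one_of_least hL
  have hHL : ¬ H.1 ≤ L := fun h => by
    have := faceRank_strictMono.monotone h
    rw [H.2, hLr] at this
    omega
  have hHF : ∀ F ∈ A, F ≠ L → H.1 ≤ F := fun F hF hFL => by
    refine A.le_of_faceRank_le hH hF ?_
    have := faceRank_strictMono (lt_of_le_of_ne (hL F) hFL.symm)
    rw [H.2]
    omega
  have key : ∀ ζ η : Vertex K → Fin n, ζ H ≠ η H → (∀ H', H' ≠ H → ζ H' = η H') →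
      (powerFlag A ζ : Set (PowerComplex n K)) \ powerFlag A η = {powerFace L ζ} := by
    intro ζ η hne heq
    ext x
    constructor
    · rintro ⟨rfl | ⟨F, hF, rfl⟩, h2⟩
      · exact (h2 (bot_mem_powerFlag A η)).elim
      · by_cases hFL : F = L
        · subst hFL
          rfl
        · refine (h2 (powerFace_mem_powerFlag_iff.2 ⟨hF, fun H' hH' => ?_⟩)).elim
          refine (heq H' ?_).symm
          rintro rfl
          exact hH' (hHF F hF hFL)
    · rintro rfl
      refine ⟨powerFace_mem_powerFlag (A.mem_of_forall_le hL), fun h => ?_⟩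
      exact hne ((powerFace_mem_powerFlag_iff.1 h).2 H hHL).symm
  rw [FlagAdjacent, key ζ η hne heq, key η ζ hne.symm fun H' h => (heq H' h).symm]
  simp

/-- Two flags are joined by first changing the vector coordinate by coordinate, and then changing
the flag of `K`. To change the coordinate of a vertex, the flag of `K` is moved to one that contains
this vertex, and back. -/
theorem strongly_flag_connected_powerComplex [Finite K] {k : ℕ} (hK : IsIncidenceComplex k K)
    (hn : 0 < n) (X Y : Flag (PowerComplex n K)) :
    Relation.ReflTransGen
      (fun Z W : Flag (PowerComplex n K) => FlagAdjacent Z W ∧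
        (X : Set (PowerComplex n K)) ∩ (Y : Set (PowerComplex n K)) ⊆ Z ∧
        (X : Set (PowerComplex n K)) ∩ (Y : Set (PowerComplex n K)) ⊆ W) X Y := by
  classical
  have := Fintype.ofFinite (Vertex K)
  obtain ⟨A, ζ, rfl⟩ := exists_eq_powerFlag hK hn X
  obtain ⟨B, η, rfl⟩ := exists_eq_powerFlag hK hn Y
  set r := (fun Z W : Flag (PowerComplex n K) => FlagAdjacent Z W ∧
        (powerFlag A ζ : Set (PowerComplex n K)) ∩ (powerFlag B η : Set (PowerComplex n K)) ⊆ Z ∧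
        (powerFlag A ζ : Set (PowerComplex n K)) ∩ (powerFlag B η : Set (PowerComplex n K)) ⊆ W)
  -- `D` consists of the faces of `K` from which the common faces of the two flags come
  let D : Set K := {F | (F ∈ A ∧ F ∈ B) ∧ ∀ H : Vertex K, ¬ H.1 ≤ F → ζ H = η H}
  let good : (Vertex K → Fin n) → Prop := fun ξ => ∀ F ∈ D, ∀ H : Vertex K, ¬ H.1 ≤ F → ξ H = ζ H
  have hsub : ∀ (A' : Flag K) (ξ : Vertex K → Fin n), D ⊆ A' → good ξ →
      (powerFlag A ζ : Set (PowerComplex n K)) ∩ (powerFlag B η : Set (PowerComplex n K)) ⊆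
        powerFlag A' ξ := by
    rintro A' ξ hA' hξ x ⟨rfl | ⟨F, hF, rfl⟩, h2⟩
    · exact bot_mem_powerFlag A' ξ
    · have h2' := powerFace_mem_powerFlag_iff.1 h2
      have hFD : F ∈ D := ⟨⟨hF, h2'.1⟩, fun H hH => (h2'.2 H hH).symm⟩
      exact powerFace_mem_powerFlag_iff.2 ⟨hA' hFD, hξ F hFD⟩
  have conn : ∀ (A' A'' : Flag K) (ξ : Vertex K → Fin n), D ⊆ A' → D ⊆ A'' → good ξ →
      Relation.ReflTransGen r (powerFlag A' ξ) (powerFlag A'' ξ) := by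
    intro A' A'' ξ h' h'' hξ
    refine Relation.ReflTransGen.lift (r := fun Z W : Flag K => FlagAdjacent Z W ∧
      (A' : Set K) ∩ (A'' : Set K) ⊆ Z ∧ (A' : Set K) ∩ (A'' : Set K) ⊆ W)
      (fun A => powerFlag A ξ) (fun Z W hZW => ?_) _ _ (hK.strongly_flag_connected A' A'')
    exact ⟨hZW.1.map_powerFlag ξ, hsub Z ξ ((Set.subset_inter h' h'').trans hZW.2.1) hξ,
      hsub W ξ ((Set.subset_inter h' h'').trans hZW.2.2) hξ⟩
  have step : ∀ (H : Vertex K) (ξ ξ' : Vertex K → Fin n), good ξ → good ξ' →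
      (∀ H', H' ≠ H → ξ H' = ξ' H') →
      Relation.ReflTransGen r (powerFlag A ξ) (powerFlag A ξ') := by
    intro H ξ ξ' hξ hξ' heq
    have hDA : D ⊆ A := fun F hF => hF.1.1
    by_cases hH : ξ H = ξ' H
    · have : ξ = ξ' := funext fun H' => by
        by_cases h : H' = H
        · rw [h, hH]
        · exact heq H' h
      rw [this]
    have hHD : ∀ F ∈ D, H.1 ≤ F := fun F hF => by
      by_contra h
      exact hH ((hξ F hF H h).trans (hξ' F hF H h).symm)
    have hchain : IsChain (· ≤ ·) (insert H.1 D) :=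
      IsChain.insert (A.chain_le.mono hDA) fun F hF _ => Or.inl (hHD F hF)
    obtain ⟨A', hA'⟩ := hK.exists_flag hchain
    have hDA' : D ⊆ A' := (Set.subset_insert _ _).trans hA'
    have hadj := flagAdjacent_powerFlag_of_vertex_mem hK (hA' (Set.mem_insert _ _)) hH heq
    exact ((conn A A' ξ hDA hDA' hξ).tail ⟨hadj, hsub A' ξ hDA' hξ, hsub A' ξ' hDA' hξ'⟩).trans
      (conn A' A ξ' hDA' hDA hξ')
  have hmix : ∀ S : Finset (Vertex K), good fun H => if H ∈ S then η H else ζ H := by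
    intro S F hF H hH
    dsimp only
    split_ifs
    · exact (hF.2 H hH).symm
    · rfl
  have hS : ∀ S : Finset (Vertex K), Relation.ReflTransGen r (powerFlag A ζ)
      (powerFlag A fun H => if H ∈ S then η H else ζ H) := by
    intro S
    induction S using Finset.induction_on with
    | empty => simpa using Relation.ReflTransGen.refl
    | insert H S _ ih =>
      refine ih.trans (step H _ _ (hmix S) (hmix _) fun H' hH' => ?_)
      simp [hH']
  have h1 := hS Finset.univ
  simp only [Finset.mem_univ, if_true] at h1
  exact h1.trans (conn A B η (fun F hF => hF.1.1) (fun F hF => hF.1.2)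
    fun F hF H hH => (hF.2 H hH).symm)

/-! ### Homogeneity of the power complex -/

/-- An edge of the power complex is a cell `E(ζ)` of a vertex `E` of `K`, and has `n` vertices. -/
theorem encard_between_bot_powerFace [Finite K] {k : ℕ} (hK : IsIncidenceComplex k K) (E : Vertex K)
    (ζ : Vertex K → Fin n) :
    {x : PowerComplex n K | faceRank x = 0 ∧ ⊥ < x ∧ x < powerFace E.1 ζ}.encard = n := by
  classical
  obtain ⟨L, hL⟩ := hK.exists_least
  have hLr := faceRank_eq_neg_one_of_least hL
  have hLE : L < E.1 := lt_of_le_of_ne (hL E.1) fun h => by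
    have hE := E.2
    rw [← h, hLr] at hE
    omega
  have hEL : ¬ E.1 ≤ L := fun h => hLE.not_ge h
  let f : Fin n → PowerComplex n K := fun a => powerFace L (Function.update ζ E a)
  have hf : Function.Injective f := fun a b hab => by
    have := (powerFace_eq_iff.1 hab).2 E hEL
    simpa using this
  have himage : {x : PowerComplex n K | faceRank x = 0 ∧ ⊥ < x ∧ x < powerFace E.1 ζ} =
      f '' Set.univ := by
    ext x
    constructor
    · rintro ⟨hx, -, hxE⟩
      obtain ⟨F, η, hF, rfl⟩ := exists_eq_powerFace_of_faceRank hx le_rfl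
      have hFL : F = L := by
        by_contra h
        have := faceRank_strictMono (lt_of_le_of_ne (hL F) (Ne.symm h))
        omega
      subst hFL
      refine ⟨η E, trivial, powerFace_eq_iff.2 ⟨rfl, fun H _ => ?_⟩⟩
      by_cases hHE : H = E
      · subst hHE
        simp
      · rw [Function.update_of_ne hHE]
        refine ((powerFace_le_iff.1 hxE.le).2 H fun h => hHE (Subtype.ext ?_)).symm
        by_contra hne
        have := faceRank_strictMono (lt_of_le_of_ne h hne)
        rw [H.2, E.2] at this
        omega
    · rintro ⟨a, -, rfl⟩
      refine ⟨?_, bot_lt_iff_ne_bot.2 (powerFace_ne_bot _ _), ?_⟩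
      · rw [faceRank_powerFace, hLr]
        rfl
      · refine lt_of_le_of_ne (powerFace_le_iff.2 ⟨hL E.1, fun H hH => ?_⟩) fun h => ?_
        · rw [Function.update_of_ne]
          rintro rfl
          exact hH le_rfl
        · exact hLE.ne (powerFace_eq_iff.1 h).1
  rw [himage, hf.encard_image, Set.encard_univ]
  simp

/-- Above a vertex the power complex looks like `K`. -/
theorem encard_between_powerFace [Finite K] {F G : K} {i : ℤ} (hi : 0 ≤ i)
    (ζ : Vertex K → Fin n) :
    {x : PowerComplex n K | faceRank x = i ∧ powerFace F ζ < x ∧ x < powerFace G ζ}.encard =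
      {H : K | faceRank H = i - 1 ∧ F < H ∧ H < G}.encard := by
  rw [← (powerFace_injective ζ).encard_image]
  congr 1
  ext x
  constructor
  · rintro ⟨hx, h1, h2⟩
    obtain ⟨H, η, hH, rfl⟩ := exists_eq_powerFace_of_faceRank hx hi
    have h3 : powerFace H ζ = powerFace H η := powerFace_eq_iff.2 ⟨rfl, (powerFace_le_iff.1 h1.le).2⟩
    rw [← h3] at h1 h2
    exact ⟨H, ⟨hH, powerFace_lt_powerFace_same.1 h1, powerFace_lt_powerFace_same.1 h2⟩, h3⟩
  · rintro ⟨H, ⟨hH, h1, h2⟩, rfl⟩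
    exact ⟨by rw [faceRank_powerFace]; omega, powerFace_lt_powerFace_same.2 h1,
      powerFace_lt_powerFace_same.2 h2⟩

theorem isIncidenceComplex_powerComplex [Finite K] {k : ℕ} (hK : IsIncidenceComplex k K)
    (hn : 2 ≤ n) : IsIncidenceComplex (k + 1) (PowerComplex n K) where
  exists_least := ⟨⊥, fun _ => bot_le⟩
  exists_greatest := by
    obtain ⟨T, hT⟩ := hK.exists_greatest
    refine ⟨powerFace T fun _ => ⟨0, by omega⟩, fun x => ?_⟩
    obtain rfl | ⟨F, η, rfl⟩ := eq_bot_or_eq_powerFace x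
    · exact bot_le
    · exact powerFace_le_iff.2 ⟨hT F, fun H hH => (hH (hT _)).elim⟩
  chain_subset_flag C hC := by
    obtain ⟨A, ζ, h⟩ := exists_subset_powerFlag hK (by omega) hC
    exact ⟨powerFlag A ζ, h, encard_powerFlag hK A ζ⟩
  strongly_flag_connected := strongly_flag_connected_powerComplex hK (by omega)
  homogeneous := by
    obtain ⟨c, hc⟩ := hK.homogeneous
    refine ⟨fun i => if i = 0 then n else c (i - 1), fun i h0 h1 => ?_⟩
    push_cast at h1
    rcases h0.eq_or_lt with rfl | h0
    · refine ⟨by simpa using hn, fun x y hx hy hxy => ?_⟩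
      obtain rfl | ⟨F, η, rfl⟩ := eq_bot_or_eq_powerFace x
      · obtain ⟨E, ζ, hE, rfl⟩ := exists_eq_powerFace_of_faceRank hy (by omega)
        simpa using encard_between_bot_powerFace hK ⟨E, by omega⟩ ζ
      · rw [faceRank_powerFace] at hx
        have := neg_one_le_faceRank F
        omega
    · have hc' := hc (i - 1) (by omega) (by omega)
      dsimp only
      rw [if_neg (by omega)]
      refine ⟨hc'.1, fun x y hx hy hxy => ?_⟩
      obtain ⟨F, ζ, hF, rfl⟩ := exists_eq_powerFace_of_faceRank hx (by omega)
      obtain ⟨G, η, hG, rfl⟩ := exists_eq_powerFace_of_faceRank hy (by omega)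
      have h3 : powerFace G ζ = powerFace G η :=
        powerFace_eq_iff.2 ⟨rfl, (powerFace_le_iff.1 hxy.le).2⟩
      rw [← h3] at hxy ⊢
      rw [encard_between_powerFace (by omega)]
      exact hc'.2 F G hF (by omega) (powerFace_lt_powerFace_same.1 hxy)

/-! ### The action of the wreath product on the power complex -/

variable {U : Subgroup (Equiv.Perm (Fin n))}

theorem powerAct_powerFace (w : Wreath U K) (F : K) (ζ : Vertex K → Fin n) :
    powerAct w (powerFace F ζ) = powerFace (w.right F) (vectorAct w ζ) :=
  congrArg ((↑) : ProperPowerFace n K → WithBot (ProperPowerFace n K))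
    (Subtype.ext (Prod.ext rfl (vectorAct_image w F ζ)))

theorem vectorAct_one (ζ : Vertex K → Fin n) : vectorAct (1 : Wreath U K) ζ = ζ := by
  funext H
  simp [vectorAct]

theorem vectorAct_mul (w v : Wreath U K) (ζ : Vertex K → Fin n) :
    vectorAct (w * v) ζ = vectorAct w (vectorAct v ζ) := by
  funext H
  simp only [vectorAct, SemidirectProduct.mul_left, SemidirectProduct.mul_right, Pi.mul_apply,
    mul_inv_rev, mul_smul]
  rfl

theorem powerAct_one (x : PowerComplex n K) : powerAct (1 : Wreath U K) x = x := by
  obtain rfl | ⟨F, ζ, rfl⟩ := eq_bot_or_eq_powerFace x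
  · rfl
  · rw [powerAct_powerFace, vectorAct_one]
    rfl

theorem powerAct_mul (w v : Wreath U K) (x : PowerComplex n K) :
    powerAct (w * v) x = powerAct w (powerAct v x) := by
  obtain rfl | ⟨F, ζ, rfl⟩ := eq_bot_or_eq_powerFace x
  · rfl
  · rw [powerAct_powerFace, powerAct_powerFace, powerAct_powerFace, vectorAct_mul]
    rfl

theorem powerAct_monotone (w : Wreath U K) :
    Monotone (powerAct w : PowerComplex n K → PowerComplex n K) := by
  intro x y hxy
  obtain rfl | ⟨F, ζ, rfl⟩ := eq_bot_or_eq_powerFace x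
  · exact bot_le
  obtain rfl | ⟨G, η, rfl⟩ := eq_bot_or_eq_powerFace y
  · exact (powerFace_ne_bot F ζ (le_bot_iff.1 hxy)).elim
  rw [powerAct_powerFace, powerAct_powerFace, powerFace_le_iff]
  obtain ⟨h1, h2⟩ := powerFace_le_iff.1 hxy
  refine ⟨w.right.monotone h1, fun H hH => ?_⟩
  simp only [vectorAct]
  rw [h2]
  intro h
  exact hH ((w.right.symm_apply_le).1 h)

/-- The action of the wreath product on the power complex, as a homomorphism into its automorphism
group. -/
def powerHom (U : Subgroup (Equiv.Perm (Fin n))) (K : Type*) [PartialOrder K] :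
    Wreath U K →* (PowerComplex n K ≃o PowerComplex n K) where
  toFun w :=
    { toFun := powerAct w
      invFun := powerAct w⁻¹
      left_inv := fun x => by rw [← powerAct_mul, inv_mul_cancel, powerAct_one]
      right_inv := fun x => by rw [← powerAct_mul, mul_inv_cancel, powerAct_one]
      map_rel_iff' := fun {x y} => by
        refine ⟨fun h => ?_, fun h => powerAct_monotone w h⟩
        have h' := powerAct_monotone w⁻¹ h
        simpa only [Equiv.coe_fn_mk, ← powerAct_mul, inv_mul_cancel, powerAct_one] using h' }
  map_one' := by
    refine RelIso.ext fun x => ?_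
    exact powerAct_one x
  map_mul' w v := by
    refine RelIso.ext fun x => ?_
    exact powerAct_mul w v x

theorem powerHom_apply (w : Wreath U K) (x : PowerComplex n K) :
    powerHom U K w x = powerAct w x :=
  rfl

theorem powerHom_flagTransitive [Finite K] {k : ℕ} (hK : IsIncidenceComplex k K)
    (hreg : IsRegularComplex K) (hn : 0 < n) (hU : MulAction.IsPretransitive U (Fin n)) :
    FlagTransitive (powerHom U K) := by
  intro X Y
  obtain ⟨A, ζ, rfl⟩ := exists_eq_powerFlag hK hn X
  obtain ⟨B, η, rfl⟩ := exists_eq_powerFlag hK hn Y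
  obtain ⟨φ, rfl⟩ := hreg A B
  choose u hu using fun H : Vertex K => hU.exists_smul_eq (ζ (φ⁻¹ • H)) (η H)
  refine ⟨⟨u, φ⟩, Flag.eq_of_subset ?_⟩
  have hv : vectorAct (⟨u, φ⟩ : Wreath U K) ζ = η := funext hu
  rintro _ ⟨_, rfl | ⟨F, hF, rfl⟩, rfl⟩
  · exact bot_mem_powerFlag _ _
  · rw [powerHom_apply, powerAct_powerFace, hv]
    exact powerFace_mem_powerFlag (Flag.apply_mem_map _ hF)

theorem powerHom_injective [Finite K] {k : ℕ} (hK : IsIncidenceComplex k K) (hn : 0 < n) :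
    Function.Injective (powerHom U K) := by
  rw [injective_iff_map_eq_one]
  intro w hw
  have h : ∀ (F : K) (ζ : Vertex K → Fin n),
      powerFace (w.right F) (vectorAct w ζ) = powerFace F ζ := fun F ζ => by
    rw [← powerAct_powerFace, ← powerHom_apply, hw]
    rfl
  have hr : w.right = 1 := by
    refine RelIso.ext fun F => ?_
    exact (powerFace_eq_iff.1 (h F fun _ => ⟨0, hn⟩)).1
  refine SemidirectProduct.ext (funext fun H => ?_) hr
  obtain ⟨L, hL⟩ := hK.exists_least
  have hHL : ¬ H.1 ≤ L := fun h => by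
    have h1 := faceRank_strictMono.monotone h
    rw [H.2, faceRank_eq_neg_one_of_least hL] at h1
    omega
  refine Subtype.ext (Equiv.ext fun a => ?_)
  have h1 := (powerFace_eq_iff.1 (h L fun _ => a)).2 H hHL
  exact h1

/-! ### Power complexes and sets of vectors -/

theorem powerSet_powerFace (F : K) (ζ : Vertex K → Fin n) :
    powerSet (powerFace F ζ) = powerCell F ζ :=
  rfl

theorem powerSet_bot : powerSet (⊥ : PowerComplex n K) = ∅ :=
  rfl

/-- Since there are at least two values for each coordinate, the vertex-set of `F` consists of the
coordinates in which the vectors of `F(ζ)` vary. -/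
theorem vertexSet_subset_of_powerCell_subset (hn : 2 ≤ n) {F G : K} {ζ η : Vertex K → Fin n}
    (h : powerCell F ζ ⊆ powerCell G η) : vertexSet F ⊆ vertexSet G := by
  classical
  intro H hH
  by_contra hHG
  have : Nontrivial (Fin n) := Fin.nontrivial_iff_two_le.2 hn
  obtain ⟨a, ha⟩ := exists_ne (η H)
  have hmem : Function.update ζ H a ∈ powerCell F ζ := fun H' hH' => by
    rw [Function.update_of_ne]
    rintro rfl
    exact hH' hH
  have := h hmem H hHG
  rw [Function.update_self] at this
  exact ha this

theorem powerSet_injective (hn : 2 ≤ n)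
    (hinj : Function.Injective (vertexSet : K → Set (Vertex K))) :
    Function.Injective (powerSet : PowerComplex n K → Set (Vertex K → Fin n)) := by
  intro x y hxy
  obtain rfl | ⟨F, ζ, rfl⟩ := eq_bot_or_eq_powerFace x <;>
    obtain rfl | ⟨G, η, rfl⟩ := eq_bot_or_eq_powerFace y
  · rfl
  · rw [powerSet_bot, powerSet_powerFace] at hxy
    exact absurd (mem_powerCell_self G η) (hxy ▸ Set.notMem_empty η)
  · rw [powerSet_bot, powerSet_powerFace] at hxy
    exact absurd (mem_powerCell_self F ζ) (hxy ▸ Set.notMem_empty ζ)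
  · rw [powerSet_powerFace, powerSet_powerFace] at hxy
    refine powerFace_eq_iff.2 ⟨hinj ?_, hxy.le (mem_powerCell_self F ζ)⟩
    exact (vertexSet_subset_of_powerCell_subset hn hxy.le).antisymm
      (vertexSet_subset_of_powerCell_subset hn hxy.ge)

theorem le_iff_powerSet_subset (hn : 2 ≤ n)
    (hle : ∀ F G : K, F ≤ G ↔ vertexSet F ⊆ vertexSet G) (x y : PowerComplex n K) :
    x ≤ y ↔ powerSet x ⊆ powerSet y := by
  obtain rfl | ⟨F, ζ, rfl⟩ := eq_bot_or_eq_powerFace x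
  · simp [powerSet_bot]
  obtain rfl | ⟨G, η, rfl⟩ := eq_bot_or_eq_powerFace y
  · refine iff_of_false (fun h => powerFace_ne_bot F ζ (le_bot_iff.1 h)) fun h => ?_
    exact h (mem_powerCell_self F ζ)
  rw [powerSet_powerFace, powerSet_powerFace]
  constructor
  · intro h ξ hξ H hH
    obtain ⟨h1, h2⟩ := powerFace_le_iff.1 h
    rw [hξ H fun h' => hH (le_trans h' h1), h2 H hH]
  · intro h
    exact powerFace_le_iff.2 ⟨(hle F G).2 (vertexSet_subset_of_powerCell_subset hn h),
      h (mem_powerCell_self F ζ)⟩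

end Power

/-! ### The system of subgroups of the wreath product -/

section System

variable {K : Type*} [PartialOrder K]

theorem flagSubgroup_eq_flagStab (Φ : Flag K) (i : ℤ) :
    flagSubgroup Φ i = flagStab (MonoidHom.id (K ≃o K)) Φ {i} :=
  rfl

theorem flagSubgroup_neg_one_le [Finite K] {k : ℕ} (hK : IsIncidenceComplex k K) (Φ : Flag K)
    (i : ℤ) : flagSubgroup Φ (-1) ≤ flagSubgroup Φ i := by
  rw [flagSubgroup_eq_flagStab, flagSubgroup_eq_flagStab, flagStab_neg_one hK]
  exact flagStab_mono (Set.empty_subset _)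

theorem apply_eq_of_mem_flagSubgroup_neg_one [Finite K] {k : ℕ} (hK : IsIncidenceComplex k K)
    {Φ : Flag K} {φ : K ≃o K} (hφ : φ ∈ flagSubgroup Φ (-1)) {F : K} (hF : F ∈ Φ) : φ F = F := by
  rw [flagSubgroup_eq_flagStab, flagStab_neg_one hK] at hφ
  exact hφ F hF (Set.notMem_empty _)

theorem mem_map_inr_iff {A : Type*} [Group A] {S : Subgroup (K ≃o K)} {w : Wreath A K} :
    w ∈ S.map SemidirectProduct.inr ↔ w.left = 1 ∧ w.right ∈ S := by
  constructor
  · rintro ⟨φ, hφ, rfl⟩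
    exact ⟨rfl, hφ⟩
  · rintro ⟨h1, h2⟩
    exact ⟨w.right, h2, SemidirectProduct.ext h1.symm rfl⟩

theorem mem_coordSubgroup_iff {A : Type*} [Group A] {F₀ : Vertex K} {w : Wreath A K} :
    w ∈ coordSubgroup A F₀ ↔ ∃ a, coordElt F₀ a = w := by
  classical
  let f : A →* Wreath A K := SemidirectProduct.inl.comp (MonoidHom.mulSingle (fun _ => A) F₀)
  have hf : ∀ a, f a = coordElt F₀ a := fun a => by
    simp only [f, coordElt, MonoidHom.comp_apply, MonoidHom.mulSingle_apply]
  have hr : Set.range (coordElt (A := A) F₀) = f.range := by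
    ext w
    simp only [Set.mem_range, SetLike.mem_coe, MonoidHom.mem_range, hf]
  rw [coordSubgroup, hr, Subgroup.closure_eq, MonoidHom.mem_range]
  simp only [hf]

theorem mem_coordSubgroup_iff_forall {A : Type*} [Group A] {F₀ : Vertex K} {w : Wreath A K} :
    w ∈ coordSubgroup A F₀ ↔ w.right = 1 ∧ ∀ H, H ≠ F₀ → w.left H = 1 := by
  classical
  rw [mem_coordSubgroup_iff]
  constructor
  · rintro ⟨a, rfl⟩
    refine ⟨rfl, fun H hH => ?_⟩
    simp only [coordElt, SemidirectProduct.left_inl]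
    exact Pi.mulSingle_eq_of_ne (M := fun _ => A) hH a
  · rintro ⟨h1, h2⟩
    refine ⟨w.left F₀, SemidirectProduct.ext (funext fun H => ?_) h1.symm⟩
    simp only [coordElt, SemidirectProduct.left_inl]
    by_cases hH : H = F₀
    · subst hH
      exact Pi.mulSingle_eq_same _ _
    · rw [h2 H hH]
      exact Pi.mulSingle_eq_of_ne hH _

/-- Conjugation by automorphisms of `K` moves the coordinates. -/
theorem inr_mul_coordElt_mul_inr_inv {A : Type*} [Group A] (φ : K ≃o K) (F₀ : Vertex K) (a : A) :
    (SemidirectProduct.inr φ : Wreath A K) * coordElt F₀ a * SemidirectProduct.inr φ⁻¹ =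
      coordElt (φ • F₀) a := by
  classical
  simp only [coordElt]
  rw [← SemidirectProduct.inl_aut]
  congr 1
  funext H
  by_cases hH : H = φ • F₀
  · subst hH
    rw [Pi.mulSingle_eq_same]
    change Pi.mulSingle (M := fun _ => A) F₀ a (φ⁻¹ • φ • F₀) = a
    rw [inv_smul_smul, Pi.mulSingle_eq_same]
  · rw [Pi.mulSingle_eq_of_ne hH]
    exact Pi.mulSingle_eq_of_ne (M := fun _ => A) (fun h => hH (inv_smul_eq_iff.1 h)) a

variable {n k : ℕ} {U : Subgroup (Equiv.Perm (Fin n))} {o : Fin n} {Φ : Flag K} {F₀ : Vertex K}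

theorem transitiveSystem_zero : transitiveSystem U o k Φ F₀ 0 = coordSubgroup U F₀ :=
  if_pos rfl

theorem transitiveSystem_of_mem {i : ℤ} (h1 : 1 ≤ i) (h2 : i ≤ k) :
    transitiveSystem U o k Φ F₀ i = (flagSubgroup Φ (i - 1)).map SemidirectProduct.inr := by
  rw [transitiveSystem, if_neg (by omega), if_pos ⟨h1, h2⟩]

theorem transitiveSystem_neg_one : transitiveSystem U o k Φ F₀ (-1) =
    (Subgroup.pi Set.univ fun _ : Vertex K => MulAction.stabilizer U o).map
      SemidirectProduct.inl ⊔ (flagSubgroup Φ (-1)).map SemidirectProduct.inr := by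
  rw [transitiveSystem, if_neg (by omega), if_neg (by omega)]

theorem transitiveSystem_last : transitiveSystem U o k Φ F₀ (k + 1 : ℕ) =
    transitiveSystem U o k Φ F₀ (-1) := by
  rw [transitiveSystem_neg_one, transitiveSystem, if_neg (by omega), if_neg (by push_cast; omega)]

/-- The elements that fix faces of the base flag of the power complex, with the constant base
vector. -/
theorem mem_flagStab_powerHom_iff [Finite K] {I : Set ℤ} {w : Wreath U K} :
    w ∈ flagStab (powerHom U K) (powerFlag Φ fun _ => o) I ↔
      ∀ F ∈ Φ, faceRank F + 1 ∉ I →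
        w.right F = F ∧ ∀ H : Vertex K, ¬ H.1 ≤ F → w.left H • o = o := by
  have key : ∀ F : K, powerHom U K w (powerFace F fun _ => o) = powerFace F (fun _ => o) ↔
      w.right F = F ∧ ∀ H : Vertex K, ¬ H.1 ≤ F → w.left H • o = o := fun F => by
    rw [powerHom_apply, powerAct_powerFace, powerFace_eq_iff]
    rfl
  constructor
  · intro h F hF hI
    rw [← key]
    exact h _ (powerFace_mem_powerFlag hF) (by rwa [faceRank_powerFace])
  · rintro h _ (rfl | ⟨F, hF, rfl⟩) hI
    · rfl
    · rw [faceRank_powerFace] at hI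
      exact (key F).2 (h F hF hI)

theorem not_vertex_le_least {L : K} [Finite K] (hL : ∀ F, L ≤ F) (H : Vertex K) : ¬ H.1 ≤ L :=
  fun h => by
    have h1 := faceRank_strictMono.monotone h
    rw [H.2, faceRank_eq_neg_one_of_least hL] at h1
    omega

theorem mem_flagStab_powerHom_empty_iff [Finite K] (hK : IsIncidenceComplex k K)
    {w : Wreath U K} :
    w ∈ flagStab (powerHom U K) (powerFlag Φ fun _ => o) ∅ ↔
      w.right ∈ flagSubgroup Φ (-1) ∧ ∀ H, w.left H • o = o := by
  rw [mem_flagStab_powerHom_iff]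
  constructor
  · intro h
    obtain ⟨L, hL⟩ := hK.exists_least
    exact ⟨fun F hF _ => (h F hF (Set.notMem_empty _)).1, fun H =>
      (h L (Φ.mem_of_forall_le hL) (Set.notMem_empty _)).2 H (not_vertex_le_least hL H)⟩
  · rintro ⟨h1, h2⟩ F hF -
    exact ⟨apply_eq_of_mem_flagSubgroup_neg_one hK h1 hF, fun H _ => h2 H⟩

/-- `U_o ≀ R_{-1}` is the stabilizer of the base flag of the power complex. -/
theorem transitiveSystem_neg_one_eq_flagStab [Finite K] (hK : IsIncidenceComplex k K) :
    transitiveSystem U o k Φ F₀ (-1) =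
      flagStab (powerHom U K) (powerFlag Φ fun _ => o) ∅ := by
  rw [transitiveSystem_neg_one]
  apply le_antisymm
  · refine sup_le ?_ ?_
    · rintro _ ⟨u, hu, rfl⟩
      rw [mem_flagStab_powerHom_empty_iff hK]
      exact ⟨one_mem _, fun H => hu H (Set.mem_univ H)⟩
    · rintro _ ⟨φ, hφ, rfl⟩
      rw [mem_flagStab_powerHom_empty_iff hK]
      exact ⟨hφ, fun H => one_smul U o⟩
  · intro w hw
    rw [mem_flagStab_powerHom_empty_iff hK] at hw
    rw [← SemidirectProduct.inl_left_mul_inr_right w]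
    exact mul_mem (Subgroup.mem_sup_left ⟨w.left, fun H _ => hw.2 H, rfl⟩)
      (Subgroup.mem_sup_right ⟨w.right, hw.1, rfl⟩)

theorem mem_transitiveSystem_neg_one_iff [Finite K] (hK : IsIncidenceComplex k K)
    {w : Wreath U K} : w ∈ transitiveSystem U o k Φ F₀ (-1) ↔
      w.right ∈ flagSubgroup Φ (-1) ∧ ∀ H, w.left H • o = o := by
  rw [transitiveSystem_neg_one_eq_flagStab hK, mem_flagStab_powerHom_empty_iff hK]

theorem vertex_le_iff_eq [Finite K] {H F₀ : Vertex K} : H.1 ≤ F₀.1 ↔ H = F₀ := by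
  refine ⟨fun h => Subtype.ext ?_, fun h => h ▸ le_rfl⟩
  by_contra hne
  have := faceRank_strictMono (lt_of_le_of_ne h hne)
  rw [H.2, F₀.2] at this
  omega

theorem transitiveSystem_le_flagStab [Finite K] (hK : IsIncidenceComplex k K) (hF₀ : F₀.1 ∈ Φ)
    {i : ℤ} (hi : i ∈ Set.Icc (-1 : ℤ) (k + 1 : ℕ)) :
    transitiveSystem U o k Φ F₀ i ≤ flagStab (powerHom U K) (powerFlag Φ fun _ => o) {i} := by
  obtain ⟨h1, h2⟩ := hi
  rcases h1.eq_or_lt with rfl | h1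
  · rw [transitiveSystem_neg_one_eq_flagStab hK]
    exact flagStab_mono (Set.empty_subset _)
  rcases h2.eq_or_lt with rfl | h2
  · rw [transitiveSystem_last, transitiveSystem_neg_one_eq_flagStab hK]
    exact flagStab_mono (Set.empty_subset _)
  intro w hw
  rw [mem_flagStab_powerHom_iff]
  intro F hF hFi
  by_cases h0 : i = 0
  · subst h0
    rw [transitiveSystem_zero, mem_coordSubgroup_iff_forall] at hw
    refine ⟨by rw [hw.1]; rfl, fun H hH => ?_⟩
    rw [hw.2 H, one_smul]
    rintro rfl
    have h3 := neg_one_le_faceRank F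
    simp only [Set.mem_singleton_iff] at hFi
    exact hH (Φ.le_of_faceRank_le hF₀ hF (by rw [H.2]; omega))
  · rw [transitiveSystem_of_mem (by omega) (by push_cast at h2; omega), mem_map_inr_iff] at hw
    refine ⟨hw.2 F hF fun h => hFi (by simp [h]), fun H _ => ?_⟩
    rw [hw.1, Pi.one_apply, one_smul]

theorem flagStab_le_transitiveSystem [Finite K] (hK : IsIncidenceComplex k K) (hn : 2 ≤ n)
    (hF₀ : F₀.1 ∈ Φ) {i : ℤ} (hi : i ∈ Set.Icc (-1 : ℤ) (k + 1 : ℕ)) :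
    flagStab (powerHom U K) (powerFlag Φ fun _ => o) {i} ≤
      transitiveSystem U o k Φ F₀ (-1) ⊔ transitiveSystem U o k Φ F₀ i := by
  classical
  obtain ⟨h1, h2⟩ := hi
  rcases h1.eq_or_lt with rfl | h1
  · rw [transitiveSystem_neg_one_eq_flagStab hK,
      flagStab_neg_one (isIncidenceComplex_powerComplex hK hn)]
    exact le_sup_left
  rcases h2.eq_or_lt with rfl | h2
  · rw [transitiveSystem_neg_one_eq_flagStab hK,
      flagStab_top (isIncidenceComplex_powerComplex hK hn)]
    exact le_sup_left
  intro w hw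
  rw [mem_flagStab_powerHom_iff] at hw
  by_cases h0 : i = 0
  · subst h0
    rw [transitiveSystem_zero]
    have hleft : ∀ H, H ≠ F₀ → w.left H • o = o := fun H hH =>
      (hw F₀.1 hF₀ (by rw [F₀.2]; simp)).2 H fun h => hH (vertex_le_iff_eq.1 h)
    have hright : w.right ∈ flagSubgroup Φ (-1) := fun F hF hFr =>
      (hw F hF (by
        simp only [Set.mem_singleton_iff]
        omega)).1
    -- split off the coordinate `F₀`
    have hmem : (coordElt F₀ (w.left F₀))⁻¹ * w ∈ transitiveSystem U o k Φ F₀ (-1) := by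
      rw [mem_transitiveSystem_neg_one_iff hK]
      have hl : ∀ H, ((coordElt F₀ (w.left F₀))⁻¹ * w).left H =
          (Pi.mulSingle (M := fun _ => U) F₀ (w.left F₀) H)⁻¹ * w.left H := fun H => by
        simp only [coordElt, ← map_inv, SemidirectProduct.mul_left, SemidirectProduct.left_inl,
          SemidirectProduct.right_inl, map_one, MulAut.one_apply, Pi.mul_apply, Pi.inv_apply]
      refine ⟨?_, fun H => ?_⟩
      · simpa only [coordElt, ← map_inv, SemidirectProduct.mul_right, SemidirectProduct.right_inl,
          one_mul] using hright
      · rw [hl]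
        by_cases hH : H = F₀
        · subst hH
          rw [Pi.mulSingle_eq_same, inv_mul_cancel, one_smul]
        · rw [Pi.mulSingle_eq_of_ne hH, inv_one, one_mul, hleft H hH]
    rw [← mul_inv_cancel_left (coordElt F₀ (w.left F₀)) w]
    exact mul_mem (Subgroup.mem_sup_right (mem_coordSubgroup_iff.2 ⟨_, rfl⟩))
      (Subgroup.mem_sup_left hmem)
  · obtain ⟨L, hL⟩ := hK.exists_least
    have hleft : ∀ H, w.left H • o = o := fun H =>
      (hw L (Φ.mem_of_forall_le hL) (by
        rw [faceRank_eq_neg_one_of_least hL]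
        simpa using Ne.symm h0)).2 H (not_vertex_le_least hL H)
    rw [← SemidirectProduct.inl_left_mul_inr_right w]
    refine mul_mem (Subgroup.mem_sup_left ?_) (Subgroup.mem_sup_right ?_)
    · rw [mem_transitiveSystem_neg_one_iff hK]
      exact ⟨one_mem _, hleft⟩
    · rw [transitiveSystem_of_mem (by omega) (by push_cast at h2; omega)]
      refine ⟨w.right, fun F hF hFi => (hw F hF ?_).1, rfl⟩
      simp only [Set.mem_singleton_iff]
      omega

theorem genSubgroup_transitiveSystem [Finite K] (hK : IsIncidenceComplex k K)
    (hreg : IsRegularComplex K) (hn : 2 ≤ n) (hU : MulAction.IsPretransitive U (Fin n))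
    (hF₀ : F₀.1 ∈ Φ) {I : Set ℤ} (hI : I ⊆ Set.Icc (-1 : ℤ) (k + 1 : ℕ)) :
    genSubgroup (transitiveSystem U o k Φ F₀) I =
      flagStab (powerHom U K) (powerFlag Φ fun _ => o) I :=
  genSubgroup_eq_flagStab (isIncidenceComplex_powerComplex hK hn)
    (powerHom_flagTransitive hK hreg (by omega) hU) (transitiveSystem_neg_one_eq_flagStab hK)
    (fun _ hi => transitiveSystem_le_flagStab hK hF₀ hi)
    (fun _ hi => flagStab_le_transitiveSystem hK hn hF₀ hi) hI

/-- `U_o ≀ R_{-1}` commutes with each `R_i`, since `R_{-1} ≤ R_i` and `U_o ^ V` is normalized by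
`Γ(K)`. -/
theorem transitiveSystem_neg_one_mul_comm [Finite K] (hK : IsIncidenceComplex k K) {i : ℤ}
    (h1 : 1 ≤ i) (h2 : i ≤ k) :
    (transitiveSystem U o k Φ F₀ (-1) : Set (Wreath U K)) * transitiveSystem U o k Φ F₀ i =
      transitiveSystem U o k Φ F₀ i * transitiveSystem U o k Φ F₀ (-1) := by
  apply Subgroup.mul_comm_of_subset
  rintro _ ⟨w, hw, v, hv, rfl⟩
  rw [SetLike.mem_coe, mem_transitiveSystem_neg_one_iff hK] at hw
  rw [SetLike.mem_coe, transitiveSystem_of_mem h1 h2, mem_map_inr_iff] at hv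
  have hr : w.right * v.right ∈ flagSubgroup Φ (i - 1) :=
    mul_mem (flagSubgroup_neg_one_le hK Φ _ hw.1) hv.2
  have hl : (w * v).left = w.left := by
    rw [SemidirectProduct.mul_left, hv.1, map_one, mul_one]
  refine ⟨SemidirectProduct.inr (w.right * v.right), ?_,
    (SemidirectProduct.inr (w.right * v.right))⁻¹ * (w * v), ?_, mul_inv_cancel_left _ _⟩
  · rw [SetLike.mem_coe, transitiveSystem_of_mem h1 h2]
    exact ⟨_, hr, rfl⟩
  · rw [SetLike.mem_coe, mem_transitiveSystem_neg_one_iff hK]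
    refine ⟨?_, fun H => ?_⟩
    · rw [← map_inv, SemidirectProduct.mul_right, SemidirectProduct.right_inr,
        SemidirectProduct.mul_right, inv_mul_cancel]
      exact one_mem _
    · rw [← map_inv, SemidirectProduct.mul_left, SemidirectProduct.left_inr, one_mul, hl]
      exact hw.2 _

theorem transitiveSystem_zero_mul_neg_one [Finite K] (hK : IsIncidenceComplex k K)
    (hF₀ : F₀.1 ∈ Φ) :
    (transitiveSystem U o k Φ F₀ 0 : Set (Wreath U K)) * transitiveSystem U o k Φ F₀ (-1) =
      transitiveSystem U o k Φ F₀ (-1) * transitiveSystem U o k Φ F₀ 0 := by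
  apply Subgroup.mul_comm_of_subset
  rintro _ ⟨x, hx, w, hw, rfl⟩
  refine ⟨w, hw, w⁻¹ * (x * w), ?_, mul_inv_cancel_left _ _⟩
  rw [SetLike.mem_coe, mem_transitiveSystem_neg_one_iff hK] at hw
  rw [SetLike.mem_coe, transitiveSystem_zero, mem_coordSubgroup_iff_forall] at hx ⊢
  refine ⟨?_, fun H hH => ?_⟩
  · rw [SemidirectProduct.mul_right, SemidirectProduct.mul_right, SemidirectProduct.inv_right,
      hx.1, one_mul, inv_mul_cancel]
  · have hH' : w.right • H ≠ F₀ := by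
      intro h
      apply hH
      apply Subtype.ext
      apply w.right.injective
      rw [apply_eq_of_mem_flagSubgroup_neg_one hK hw.1 hF₀]
      exact congrArg Subtype.val h
    have : (w⁻¹ * (x * w)).left H =
        (w.left (w.right • H))⁻¹ * (x.left (w.right • H) * w.left (x.right⁻¹ • w.right • H)) := by
      simp only [SemidirectProduct.mul_left, SemidirectProduct.inv_left,
        SemidirectProduct.inv_right, Pi.mul_apply, coordAut, MonoidHom.coe_mk, OneHom.coe_mk,
        MulEquiv.coe_mk, Equiv.coe_fn_mk, inv_inv, Pi.inv_apply]
    rw [this, hx.1, hx.2 _ hH', inv_one, one_smul, one_mul, inv_mul_cancel]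

theorem transitiveSystem_zero_mul_comm (hF₀ : F₀.1 ∈ Φ) {i : ℤ} (h1 : 2 ≤ i) (h2 : i ≤ k) :
    (transitiveSystem U o k Φ F₀ 0 : Set (Wreath U K)) * transitiveSystem U o k Φ F₀ i =
      transitiveSystem U o k Φ F₀ i * transitiveSystem U o k Φ F₀ 0 := by
  apply Subgroup.mul_comm_of_subset
  rintro _ ⟨x, hx, w, hw, rfl⟩
  refine ⟨w, hw, x, hx, ?_⟩
  rw [SetLike.mem_coe, transitiveSystem_zero, mem_coordSubgroup_iff] at hx
  rw [SetLike.mem_coe, transitiveSystem_of_mem (by omega) h2] at hw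
  obtain ⟨a, rfl⟩ := hx
  obtain ⟨φ, hφ, rfl⟩ := hw
  have hφF : φ • F₀ = F₀ := Subtype.ext (hφ F₀.1 hF₀ (by rw [F₀.2]; omega))
  have h := inr_mul_coordElt_mul_inr_inv φ F₀ a
  rw [hφF, map_inv, mul_inv_eq_iff_eq_mul] at h
  exact h

/-- The commutation of the stabilizers in `Γ(K)` of the base flag without two non-adjacent faces. -/
theorem flagSubgroup_mul_comm [Finite K] (hK : IsIncidenceComplex k K)
    (hreg : IsRegularComplex K) {i j : ℤ} (hi : -1 ≤ i) (hij : i < j - 1) (hj : j ≤ k) :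
    (flagSubgroup Φ i : Set (K ≃o K)) * flagSubgroup Φ j = flagSubgroup Φ j * flagSubgroup Φ i :=
  Subgroup.mul_comm_of_mul_eq (flagStab_pair_mul hK hreg hi hij hj)

theorem transitiveSystem_mul_comm [Finite K] (hK : IsIncidenceComplex k K)
    (hreg : IsRegularComplex K) (hF₀ : F₀.1 ∈ Φ) {i j : ℤ} (hi : -1 ≤ i) (hij : i < j - 1)
    (hj : j ≤ (k + 1 : ℕ)) :
    (transitiveSystem U o k Φ F₀ i : Set (Wreath U K)) * transitiveSystem U o k Φ F₀ j =
      transitiveSystem U o k Φ F₀ j * transitiveSystem U o k Φ F₀ i := by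
  rcases hj.eq_or_lt with rfl | hj
  · rw [transitiveSystem_last]
    push_cast at hij
    rcases hi.eq_or_lt with rfl | hi
    · rfl
    by_cases h0 : i = 0
    · subst h0
      exact transitiveSystem_zero_mul_neg_one hK hF₀
    · exact (transitiveSystem_neg_one_mul_comm hK (by omega) (by omega)).symm
  push_cast at hj
  rcases hi.eq_or_lt with rfl | hi
  · exact transitiveSystem_neg_one_mul_comm hK (by omega) (by omega)
  by_cases h0 : i = 0
  · subst h0
    exact transitiveSystem_zero_mul_comm hF₀ (by omega) (by omega)
  rw [transitiveSystem_of_mem (i := i) (by omega) (by omega),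
    transitiveSystem_of_mem (i := j) (by omega) (by omega), Subgroup.coe_map, Subgroup.coe_map,
    ← Set.image_mul, ← Set.image_mul,
    flagSubgroup_mul_comm hK hreg (by omega) (by omega) (by omega)]

/-- The wreath product is generated without the stabilizer of the base flag: the `R i` generate
`Γ(K)`, whose elements conjugate the copy of `U` in the coordinate `F₀` to the copies in all other
coordinates. -/
theorem iSup_transitiveSystem_eq_top [Finite K] (hk : 1 ≤ k) (hK : IsIncidenceComplex k K)
    (hreg : IsRegularComplex K) (hF₀ : F₀.1 ∈ Φ) :
    (⨆ i ∈ Set.Icc (0 : ℤ) k, transitiveSystem U o k Φ F₀ i) = ⊤ := by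
  classical
  set T := ⨆ i ∈ Set.Icc (0 : ℤ) k, transitiveSystem U o k Φ F₀ i
  have hle : ∀ i ∈ Set.Icc (0 : ℤ) k, transitiveSystem U o k Φ F₀ i ≤ T := fun i hi =>
    le_iSup₂ (f := fun i _ => transitiveSystem U o k Φ F₀ i) i hi
  have hflag : ∀ i : ℤ, 0 ≤ i → i < k →
      flagStab (MonoidHom.id (K ≃o K)) Φ {i} ≤ T.comap SemidirectProduct.inr := by
    intro i h0 h1
    rw [← Subgroup.map_le_iff_le_comap]
    have h := hle (i + 1) ⟨by omega, by omega⟩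
    rwa [transitiveSystem_of_mem (by omega) (by omega), add_sub_cancel_right] at h
  have hempty : flagStab (MonoidHom.id (K ≃o K)) Φ ∅ ≤ T.comap SemidirectProduct.inr :=
    (flagStab_mono (Set.empty_subset _)).trans (hflag 0 le_rfl (by omega))
  have hinr : ∀ φ : K ≃o K, SemidirectProduct.inr φ ∈ T := by
    intro φ
    have h : flagStab (MonoidHom.id (K ≃o K)) Φ (Set.Icc (-1 : ℤ) k) ≤
        T.comap SemidirectProduct.inr := by
      refine flagStab_le_of_singletons hK hreg hempty fun i hi => ?_
      obtain ⟨h1, h2⟩ := hi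
      rcases h1.eq_or_lt with rfl | h1
      · rwa [flagStab_neg_one hK]
      rcases h2.eq_or_lt with rfl | h2
      · rwa [flagStab_top hK]
      exact hflag i (by omega) h2
    rw [flagStab_Icc hK] at h
    exact h (Subgroup.mem_top φ)
  have hcoord : ∀ (H : Vertex K) (a : U), coordElt H a ∈ T := by
    intro H a
    obtain ⟨A, hA⟩ := hK.exists_mem_flag H.1
    obtain ⟨φ, rfl⟩ := hreg Φ A
    obtain ⟨E, hE, hEH⟩ := hA
    have hφ : φ • F₀ = H := by
      apply Subtype.ext
      have : F₀.1 = E := Φ.eq_of_faceRank_eq hF₀ hE (by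
        rw [F₀.2, ← faceRank_apply φ E]
        exact (H.2.symm.trans (congrArg faceRank hEH.symm)))
      rw [← hEH, ← this]
      rfl
    rw [← hφ, ← inr_mul_coordElt_mul_inr_inv]
    refine mul_mem (mul_mem (hinr φ) ?_) (hinr φ⁻¹)
    exact hle 0 ⟨le_rfl, by omega⟩ (by
      rw [transitiveSystem_zero]
      exact mem_coordSubgroup_iff.2 ⟨a, rfl⟩)
  refine eq_top_iff.2 fun w _ => ?_
  rw [← SemidirectProduct.inl_left_mul_inr_right w]
  refine mul_mem ?_ (hinr w.right)
  refine Subgroup.pi_mem_of_mulSingle_mem (H := T.comap SemidirectProduct.inl) w.left fun H => ?_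
  convert hcoord H (w.left H) using 1
  simp only [coordElt, Subgroup.mem_comap]

/-! ### The cyclic case -/

theorem isPretransitive_zpowers_of_isCycle {c : Equiv.Perm (Fin n)} (hc : c.IsCycle)
    (hs : c.support = Finset.univ) :
    MulAction.IsPretransitive (Subgroup.zpowers c) (Fin n) := by
  have hne : ∀ a, c a ≠ a := fun a => Equiv.Perm.mem_support.1 (by rw [hs]; exact Finset.mem_univ a)
  refine ⟨fun a b => ?_⟩
  obtain ⟨j, hj⟩ := hc.exists_zpow_eq (hne a) (hne b)
  exact ⟨⟨c ^ j, j, rfl⟩, hj⟩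

/-- A transitive cyclic group acts regularly, so that the stabilizers of points vanish. -/
theorem stabilizer_zpowers_eq_bot {c : Equiv.Perm (Fin n)} (hc : c.IsCycle)
    (hs : c.support = Finset.univ) (o : Fin n) :
    MulAction.stabilizer (Subgroup.zpowers c) o = ⊥ := by
  rw [eq_bot_iff]
  rintro ⟨_, j, rfl⟩ hg
  have hj : (c ^ j) o = o := hg
  refine Subgroup.mem_bot.2 (Subtype.ext (Equiv.ext fun a => ?_))
  obtain ⟨⟨_, i, rfl⟩, hi⟩ := (isPretransitive_zpowers_of_isCycle hc hs).exists_smul_eq o a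
  have hi : (c ^ i) o = a := hi
  change (c ^ j) a = a
  rw [← hi, ← Equiv.Perm.mul_apply, ← zpow_add, add_comm, zpow_add, Equiv.Perm.mul_apply, hj]

theorem cyclicSystem_eq_transitiveSystem {c : Equiv.Perm (Fin n)} (hc : c.IsCycle)
    (hs : c.support = Finset.univ) (o : Fin n) :
    cyclicSystem c k Φ F₀ = transitiveSystem (Subgroup.zpowers c) o k Φ F₀ := by
  classical
  funext i
  rw [cyclicSystem, transitiveSystem]
  split_ifs with h0 h1
  · apply le_antisymm
    · rw [Subgroup.zpowers_le]
      exact mem_coordSubgroup_iff.2 ⟨_, rfl⟩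
    · intro w hw
      obtain ⟨⟨_, j, rfl⟩, rfl⟩ := mem_coordSubgroup_iff.1 hw
      refine ⟨j, ?_⟩
      simp only [coordElt, ← map_zpow, ← Pi.mulSingle_zpow]
      rfl
  · rfl
  · have : (Subgroup.pi Set.univ fun _ : Vertex K =>
        MulAction.stabilizer (Subgroup.zpowers c) o) = ⊥ := by
      rw [stabilizer_zpowers_eq_bot hc hs]
      exact Subgroup.pi_bot
    rw [this, Subgroup.map_bot, bot_sup_eq]

end System

/-! ### Distinguished systems for transitive groups -/

theorem transitiveSystem_recovers {K : Type*} [PartialOrder K] [Finite K] {k : ℕ} (hk : 1 ≤ k)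
    (hK : IsIncidenceComplex k K) (hreg : IsRegularComplex K) {Φ : Flag K} {F₀ : Vertex K}
    (hF₀ : F₀.1 ∈ Φ) {n : ℕ} (hn : 2 ≤ n) {U : Subgroup (Equiv.Perm (Fin n))}
    (hU : MulAction.IsPretransitive U (Fin n)) (o : Fin n) :
    ((⨆ i ∈ Set.Icc (0 : ℤ) k, transitiveSystem U o k Φ F₀ i) = ⊤) ∧
      IsDistinguishedSystem (k + 1) (transitiveSystem U o k Φ F₀) ∧
      CosetComplexRecovers (k + 1) (transitiveSystem U o k Φ F₀) (PowerComplex n K) powerAct := by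
  have hP := isIncidenceComplex_powerComplex hK hn
  have hgen : ∀ I ⊆ Set.Icc (-1 : ℤ) (k + 1 : ℕ), genSubgroup (transitiveSystem U o k Φ F₀) I =
      flagStab (powerHom U K) (powerFlag Φ fun _ => o) I := fun I hI =>
    genSubgroup_transitiveSystem hK hreg hn hU hF₀ hI
  exact ⟨iSup_transitiveSystem_eq_top hk hK hreg hF₀,
    isDistinguishedSystem_of_genSubgroup_eq_flagStab hP transitiveSystem_last.symm hgen
      fun i j hi hij hj => transitiveSystem_mul_comm hK hreg hF₀ hi hij hj,
    cosetComplexRecovers_of_genSubgroup_eq_flagStab hP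
      (powerHom_flagTransitive hK hreg (by omega) hU) (powerHom_injective hK (by omega)) hgen
      powerHom_apply⟩

theorem mainTheorem4 {K : Type*} [PartialOrder K] [Finite K] (k : ℕ) (hk : 1 ≤ k)
    (hK : IsIncidenceComplex k K) (hreg : IsRegularComplex K)
    (Φ : Flag K) (F₀ : Vertex K) (hF₀ : F₀.1 ∈ Φ) (n : ℕ) (hn : 2 ≤ n) :
    (∀ c : Equiv.Perm (Fin n), c.IsCycle → c.support = Finset.univ →
      ((⨆ i ∈ Set.Icc (0 : ℤ) k, cyclicSystem c k Φ F₀ i) = ⊤) ∧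
      IsDistinguishedSystem (k + 1) (cyclicSystem c k Φ F₀) ∧
      CosetComplexRecovers (k + 1) (cyclicSystem c k Φ F₀) (PowerComplex n K) powerAct) ∧
    (∀ U : Subgroup (Equiv.Perm (Fin n)), MulAction.IsPretransitive U (Fin n) → ∀ o : Fin n,
      ((⨆ i ∈ Set.Icc (0 : ℤ) k, transitiveSystem U o k Φ F₀ i) = ⊤) ∧
      IsDistinguishedSystem (k + 1) (transitiveSystem U o k Φ F₀) ∧
      CosetComplexRecovers (k + 1) (transitiveSystem U o k Φ F₀) (PowerComplex n K) powerAct) ∧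
    (Function.Injective (vertexSet : K → Set (Vertex K)) →
      Function.Injective (powerSet : PowerComplex n K → Set (Vertex K → Fin n))) ∧
    ((∀ F G : K, F ≤ G ↔ vertexSet F ⊆ vertexSet G) →
      ∀ x y : PowerComplex n K, x ≤ y ↔ powerSet x ⊆ powerSet y) := by
  refine ⟨fun c hc hs => ?_, fun U hU o => transitiveSystem_recovers hk hK hreg hF₀ hn hU o,
    powerSet_injective hn, le_iff_powerSet_subset hn⟩
  rw [cyclicSystem_eq_transitiveSystem hc hs ⟨0, by omega⟩]
  exact transitiveSystem_recovers hk hK hreg hF₀ hn (isPretransitive_zpowers_of_isCycle hc hs) _
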